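/- For each $n\ge 1$ let $p=p_n\le n$ be a natural number, with $p_n\to\infty$ as $n\to\infty$. Let $Y_1^n,\dots,Y_p^n$ be independent, identically distributed random vectors in $\mathbb R^n$ whose common law is rotationally invariant (invariant under every linear orthogonal transformation of $\mathbb R^n$). Let $\Delta\mathbf Y=\{\sum_{i=1}^p s_iY_i^n : s_1,\dots,s_p\ge 0,\ \sum_{i=1}^p s_i\le 1\}$ be the simplex with vertices $0,Y_1^n,\dots,Y_p^n$, and let $\operatorname{Vol}_p(\Delta\mathbf Y)$ be its $p$-dimensional volume. Put $\widetilde R_{(n)}=\log\|Y_1^n\|_2\in[-\infty,\infty)$ (with $\log 0=-\infty$), and for $1\le j\le p-1$ let $\widetilde\beta_{\frac{n-j}2,\frac j2}$ denote the logarithm of a random variable with the beta distribution with shape parameters $\frac{n-j}2,\frac j2$. For an extended-real-valued random variable $X$ and $t>0$ write $m_t(X)=\mathbb E[X\mathbf 1_{\{|X|<t\}}]$ and $v_t(X)=\mathbb E[X^2\mathbf 1_{\{|X|<t\}}]-m_t(X)^2$. Assume that there are positive constants $\sigma_n$ such that, as $n\to\infty$, $$\frac{p\,v_{\sigma_n}(\widetilde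 R_{(n)})}{\sigma_n^2}+\frac1{4\sigma_n^2}\sum_{j=1}^{p-1}v_{2\sigma_n}\big(\widetilde\beta_{\frac{n-j}2,\frac j2}\big)\to 1$$ and, for every $\varepsilon>0$, $$p\,\mathbb P\big(|\widetilde R_{(n)}|\ge\varepsilon\sigma_n\big)+\sum_{j=1}^{p-1}\mathbb P\big(|\widetilde\beta_{\frac{n-j}2,\frac j2}|\ge 2\varepsilon\sigma_n\big)\to 0 .$$ Let $(b_n)$ be a real sequence with $$b_n=p\,m_{\sigma_n}(\widetilde R_{(n)})-\log(p!)+\frac12\sum_{j=1}^{p-1}m_{2\sigma_n}\big(\widetilde\beta_{\frac{n-j}2,\frac j2}\big)+o(\sigma_n).$$ Then $\mathbb P(\operatorname{Vol}_p(\Delta\mathbf Y)=0)\to0$ and $$\frac{\log\operatorname{Vol}_p(\Delta\mathbf Y)-b_n}{\sigma_n}\ \xrightarrow{\ d\ }\ N(0,1),\qquad n\to\infty,$$ where the value assigned to the logarithm on the event $\{\operatorname{Vol}_p(\Delta\mathbf Y)=0\}$ is immaterial. -/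

import Mathlib

open MeasureTheory ProbabilityTheory Filter Asymptotics
open scoped Topology ENNReal Nat

noncomputable section

/-- The simplex with vertices `0, y₁, …, y_p`. -/
def cornerSimplex {n p : ℕ} (y : Fin p → EuclideanSpace ℝ (Fin n)) :
    Set (EuclideanSpace ℝ (Fin n)) :=
  {x | ∃ s : Fin p → ℝ, (∀ i, 0 ≤ s i) ∧ ∑ i, s i ≤ 1 ∧ x = ∑ i, s i • y i}

/-- The `p`-dimensional volume of the simplex with vertices `0, y₁, …, y_p`. The measure `μHE[p]` is
the `p`-dimensional Hausdorff measure, normalised to agree with Lebesgue measure on `p`-dimensional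
subspaces. -/
def simplexVolume {n p : ℕ} (y : Fin p → EuclideanSpace ℝ (Fin n)) : ℝ :=
  (μHE[p] (cornerSimplex y)).toReal

/-- Invariance of a measure on `ℝⁿ` under all linear orthogonal transformations. -/
def IsRotationInvariant {n : ℕ} (ν : Measure (EuclideanSpace ℝ (Fin n))) : Prop :=
  ∀ T : EuclideanSpace ℝ (Fin n) ≃ₗᵢ[ℝ] EuclideanSpace ℝ (Fin n), ν.map T = ν

/-- The radial law of a measure on `ℝⁿ`, i.e. the law of the Euclidean norm. -/
def radialLaw {n : ℕ} (ν : Measure (EuclideanSpace ℝ (Fin n))) : Measure ℝ :=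
  ν.map fun y => ‖y‖

/-- `E[log X · 1{|log X| < t}]` for a nonnegative random variable `X` with law `ρ`
(with `log 0 = -∞`, so that `X = 0` does not contribute). -/
def truncLogMean (ρ : Measure ℝ) (t : ℝ) : ℝ :=
  ∫ r in {r : ℝ | 0 < r ∧ |Real.log r| < t}, Real.log r ∂ρ

/-- `E[(log X)² · 1{|log X| < t}] - (E[log X · 1{|log X| < t}])²` for a nonnegative random
variable `X` with law `ρ`. -/
def truncLogVar (ρ : Measure ℝ) (t : ℝ) : ℝ :=
  (∫ r in {r : ℝ | 0 < r ∧ |Real.log r| < t}, (Real.log r) ^ 2 ∂ρ) - (truncLogMean ρ t) ^ 2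

/-- `P(|log X| ≥ t)` for a nonnegative random variable `X` with law `ρ`
(with `log 0 = -∞`, so that the event contains `X = 0`). -/
def logTail (ρ : Measure ℝ) (t : ℝ) : ℝ :=
  ρ.real {r : ℝ | r = 0 ∨ t ≤ |Real.log r|}

/-- The beta distribution with shape parameters `(n - j) / 2` and `j / 2`. -/
def betaLaw (n j : ℕ) : Measure ℝ :=
  betaMeasure (((n : ℝ) - (j : ℝ)) / 2) ((j : ℝ) / 2)

end

/-! The volume is `√(det G) / p!`, with `G` the Gram matrix of the vectors. Adding a vector
multiplies `det G` by its squared distance to the span of the previous ones. By rotation invariance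
a vector is its norm times an independent uniform direction. Given a `j`-dimensional span, the
squared distance is therefore the squared norm times a factor whose law depends only on `n` and `j`,
namely beta with parameters `(n - j) / 2`, `j / 2`. So `log det G` behaves like a sum of independent
terms: `p` copies of `2 log ‖Y₁‖` and the logarithms of beta variables, `1 ≤ j < p`.

Only the resulting product formula for characteristic functions is proved (`det_gram_pi`,
`integral_cexp_log_det_gram_pi`). The projection factor is the same for every rotation invariant
law, so it is read off from the Gaussian one as a quotient of Gamma functions, and `logChar_betaLaw`
recognises the beta law.

The limit theorem is then Lindeberg's argument in quantitative form. Each centred factor is within a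
constant times `ε · variance + tail` of a Gaussian factor (`norm_logChar_mul_sub_exp_le`).
Telescoping the product adds these errors up to `ε V + T`, where `V → 1` and `T → 0` are the two
hypotheses. An atom of the law at the origin is removed at cost `p ν{0} ≤ T`. Lévy's continuity
theorem concludes. -/

/-- The characteristic function of `log X` on the event `X > 0`, for `X` with law `ρ`. -/
noncomputable def logChar (ρ : Measure ℝ) (t : ℝ) : ℂ :=
  ∫ r in Set.Ioi 0, Complex.exp ((t * Real.log r : ℝ) * Complex.I) ∂ρ

/-! ### Elementary estimates for exponentials and products -/

lemma norm_cexp_mul_I_sub_taylor_two_le (z : ℝ) :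
    ‖Complex.exp (z * Complex.I) - (1 + z * Complex.I - (z : ℂ) ^ 2 / 2)‖ ≤ 4 * |z| ^ 3 := by
  rcases le_total |z| 1 with h | h
  · have hz : ‖(z : ℂ) * Complex.I‖ ≤ 1 := by simpa using h
    have := Complex.exp_bound hz (n := 3) (by norm_num)
    simp only [Finset.sum_range_succ, Finset.sum_range_zero] at this
    have e : (0 + ((z : ℂ) * Complex.I) ^ 0 / (Nat.factorial 0 : ℂ)
        + ((z : ℂ) * Complex.I) ^ 1 / (Nat.factorial 1 : ℂ)
        + ((z : ℂ) * Complex.I) ^ 2 / (Nat.factorial 2 : ℂ))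
        = 1 + z * Complex.I - (z : ℂ) ^ 2 / 2 := by
      simp [mul_pow, Nat.factorial]; ring
    rw [e] at this
    refine this.trans ?_
    rw [norm_mul, Complex.norm_I, mul_one, Complex.norm_real, Real.norm_eq_abs, mul_comm]
    gcongr
    norm_num [Nat.factorial]
  · have h1 : ‖Complex.exp (z * Complex.I)‖ = 1 := Complex.norm_exp_ofReal_mul_I z
    have h2 : ‖(1 + z * Complex.I - (z : ℂ) ^ 2 / 2)‖ ≤ 1 + |z| + |z| ^ 2 / 2 := by
      refine (norm_sub_le _ _).trans (add_le_add ((norm_add_le _ _).trans ?_) ?_)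
      · simp
      · simp
    refine (norm_sub_le _ _).trans ?_
    rw [h1]
    have h3 : |z| ≤ |z| ^ 2 := by nlinarith
    have h4 : |z| ^ 2 ≤ |z| ^ 3 := by nlinarith [sq_nonneg |z|]
    linarith

lemma abs_exp_neg_sub_le {x : ℝ} (hx : 0 ≤ x) : |Real.exp (-x) - (1 - x)| ≤ x ^ 2 := by
  rcases le_total x 1 with h | h
  · have := Real.abs_exp_sub_one_sub_id_le (x := -x) (by rwa [abs_neg, abs_of_nonneg hx])
    rw [neg_sq] at this
    convert this using 2
    ring
  · have h1 := Real.one_sub_le_exp_neg x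
    rw [abs_of_nonneg (by linarith)]
    have : Real.exp (-x) ≤ 1 := Real.exp_le_one_iff.2 (by linarith)
    nlinarith

lemma norm_prod_sub_prod_le {ι : Type*} (s : Finset ι) (a c : ι → ℂ)
    (ha : ∀ i ∈ s, ‖a i‖ ≤ 1) (hc : ∀ i ∈ s, ‖c i‖ ≤ 1) :
    ‖∏ i ∈ s, a i - ∏ i ∈ s, c i‖ ≤ ∑ i ∈ s, ‖a i - c i‖ := by
  classical
  induction s using Finset.induction_on with
  | empty => simp
  | insert i s hi ih =>
    rw [Finset.prod_insert hi, Finset.prod_insert hi, Finset.sum_insert hi]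
    have e : a i * ∏ j ∈ s, a j - c i * ∏ j ∈ s, c j
        = (a i - c i) * ∏ j ∈ s, a j + c i * (∏ j ∈ s, a j - ∏ j ∈ s, c j) := by ring
    have h1 : ‖∏ j ∈ s, a j‖ ≤ 1 := by
      rw [norm_prod]
      exact Finset.prod_le_one (fun _ _ => norm_nonneg _)
        fun j hj => ha j (Finset.mem_insert_of_mem hj)
    rw [e]
    refine (norm_add_le _ _).trans (add_le_add ?_ ?_)
    · rw [norm_mul]
      exact mul_le_of_le_one_right (norm_nonneg _) h1
    · rw [norm_mul]
      refine (mul_le_of_le_one_left (norm_nonneg _) (hc i (Finset.mem_insert_self _ _))).trans ?_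
      exact ih (fun j hj => ha j (Finset.mem_insert_of_mem hj))
        fun j hj => hc j (Finset.mem_insert_of_mem hj)

/-! ### Gaussian approximation of the characteristic function of one bounded variable -/

section BoundedVariable

variable {Ω : Type*} [MeasurableSpace Ω] {P : Measure Ω} [IsProbabilityMeasure P] {X : Ω → ℝ}
  {ε : ℝ}

lemma abs_integral_le_of_tail (hX : Measurable X) (hX1 : ∀ ω, |X ω| ≤ 1) (hε : 0 < ε)
    (hq : P.real {ω | ε ≤ |X ω|} ≤ ε) : |∫ ω, X ω ∂P| ≤ 2 * ε := by
  have hm : MeasurableSet {ω | ε ≤ |X ω|} := measurableSet_le measurable_const hX.abs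
  have : ∀ ω, ‖X ω‖ ≤ ε + Set.indicator {ω | ε ≤ |X ω|} (fun _ => (1 : ℝ)) ω := by
    intro ω
    by_cases h : ε ≤ |X ω|
    · rw [Set.indicator_of_mem (by exact h)]; have := hX1 ω; rw [Real.norm_eq_abs]; linarith
    · rw [Set.indicator_of_notMem (by exact h), Real.norm_eq_abs]; push Not at h; linarith
  have h2 := norm_integral_le_of_norm_le (μ := P)
    ((integrable_const ε).add ((integrable_const (1 : ℝ)).indicator hm)) (ae_of_all _ this)
  rw [Real.norm_eq_abs] at h2
  refine h2.trans ?_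
  simp only [Pi.add_apply]
  rw [integral_add (integrable_const _) ((integrable_const _).indicator hm),
    integral_indicator_const _ hm]
  simp
  linarith

lemma integral_sq_le_of_tail (hX : Measurable X) (hX1 : ∀ ω, |X ω| ≤ 1) (hε : 0 < ε)
    (hq : P.real {ω | ε ≤ |X ω|} ≤ ε) : ∫ ω, X ω ^ 2 ∂P ≤ 2 * ε := by
  -- As `|X| ≤ 1`, the event `X² ≥ ε` is contained in `|X| ≥ ε`, so the bound for means applies to
  -- `X²`.
  have := abs_integral_le_of_tail (P := P) (X := fun ω => X ω ^ 2) (ε := ε) (hX.pow_const 2)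
    (fun ω => by rw [abs_pow]; exact pow_le_one₀ (abs_nonneg _) (hX1 ω)) hε (by
      refine (measureReal_mono ?_).trans hq
      intro ω hω
      simp only [Set.mem_ofPred_eq, abs_pow] at hω ⊢
      have := hX1 ω
      nlinarith [abs_nonneg (X ω)])
  exact (le_abs_self _).trans this

/-- Second-order Taylor expansion around the mean: the remainder is a third absolute moment, at most
`3 ε v + 8 q` with `q` the tail probability. Replacing `1 - t² v / 2` by the exponential costs a
multiple of `v²`, and `v ≤ 2 ε`. The bound is linear in `v` and `q`, so that it can be summed over
the factors of a product. -/
lemma norm_integral_cexp_sub_exp_le (hX : Measurable X) (hX1 : ∀ ω, |X ω| ≤ 1) (hε : 0 < ε)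
    (hq : P.real {ω | ε ≤ |X ω|} ≤ ε) (t : ℝ) {m v : ℝ} (hm : m = ∫ ω, X ω ∂P)
    (hv : v = ∫ ω, X ω ^ 2 ∂P - m ^ 2) :
    0 ≤ v ∧ ‖∫ ω, Complex.exp ((t * (X ω - m) : ℝ) * Complex.I) ∂P
        - Complex.exp ((-(t ^ 2 * v / 2) : ℝ))‖
      ≤ (32 * |t| ^ 3 + t ^ 4) * (ε * v + P.real {ω | ε ≤ |X ω|}) := by
  have bdd : ∀ {f : Ω → ℝ} (C : ℝ), Measurable f → (∀ ω, |f ω| ≤ C) → Integrable f P :=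
    fun C hf hC => Integrable.of_bound hf.aestronglyMeasurable C (ae_of_all _ hC)
  have iX : Integrable X P := bdd 1 hX hX1
  have iX2 : Integrable (fun ω => X ω ^ 2) P := bdd 1 (hX.pow_const 2) fun ω => by
    rw [abs_pow]; exact pow_le_one₀ (abs_nonneg _) (hX1 ω)
  have hset : MeasurableSet {ω | ε ≤ |X ω|} := measurableSet_le measurable_const hX.abs
  have hmε : |m| ≤ 2 * ε := hm ▸ abs_integral_le_of_tail hX hX1 hε hq
  have hm1 : |m| ≤ 1 := by
    have := norm_integral_le_of_norm_le_const (μ := P) (f := X) (C := 1) (ae_of_all _ hX1)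
    rw [hm]; simpa using this
  set q := P.real {ω | ε ≤ |X ω|} with hqdef
  have hq0 : 0 ≤ q := measureReal_nonneg
  have iXm : Integrable (fun ω => (X ω - m) ^ 2) P := by
    refine bdd 4 ((hX.sub_const m).pow_const 2) fun ω => ?_
    have h2 : |X ω - m| ≤ 2 := (abs_sub _ _).trans (by linarith [hX1 ω])
    rw [abs_pow]; nlinarith [abs_nonneg (X ω - m)]
  have i1 : ∫ ω, (X ω - m) ∂P = 0 := by
    rw [integral_sub iX (integrable_const _)]; simp [hm]
  have i2 : ∫ ω, (X ω - m) ^ 2 ∂P = v := by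
    have e : ∀ ω, (X ω - m) ^ 2 = X ω ^ 2 - (2 * m * X ω - m ^ 2) := fun ω => by ring
    simp_rw [e]
    have iL : Integrable (fun ω => 2 * m * X ω) P := iX.const_mul _
    have iL' : Integrable (fun ω => 2 * m * X ω - m ^ 2) P := iL.sub (integrable_const _)
    rw [integral_sub iX2 iL', integral_sub iL (integrable_const _), integral_const_mul, ← hm, hv]
    simp; ring
  have hv0 : 0 ≤ v := i2 ▸ integral_nonneg fun ω => sq_nonneg _
  have hv2 : v ≤ 2 * ε := by
    have := integral_sq_le_of_tail (P := P) hX hX1 hε hq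
    nlinarith [sq_nonneg m]
  refine ⟨hv0, ?_⟩
  have key : ‖∫ ω, Complex.exp ((t * (X ω - m) : ℝ) * Complex.I) ∂P - ((1 - t ^ 2 * v / 2 : ℝ) : ℂ)‖
      ≤ 4 * |t| ^ 3 * (3 * ε * v + 8 * q) := by
    have iE : Integrable (fun ω => Complex.exp ((t * (X ω - m) : ℝ) * Complex.I)) P :=
      Integrable.of_bound (by fun_prop) 1
        (ae_of_all _ fun ω => (Complex.norm_exp_ofReal_mul_I _).le)
    have iT1 : Integrable (fun ω => (((t * (X ω - m) : ℝ) : ℂ) * Complex.I)) P :=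
      (((iX.sub (integrable_const m)).const_mul t).ofReal).mul_const _
    have iT2 : Integrable (fun ω => ((t * (X ω - m) : ℝ) : ℂ) ^ 2 / 2) P := by
      have : (fun ω => ((t * (X ω - m) : ℝ) : ℂ) ^ 2 / 2)
          = fun ω => ((t ^ 2 / 2 * (X ω - m) ^ 2 : ℝ) : ℂ) := by
        ext ω; push_cast; ring
      rw [this]
      exact (iXm.const_mul _).ofReal
    have iT12 : Integrable (fun ω => 1 + ((t * (X ω - m) : ℝ) : ℂ) * Complex.I) P :=
      (integrable_const _).add iT1
    have iT : ∫ ω, (1 + ((t * (X ω - m) : ℝ) : ℂ) * Complex.I - ((t * (X ω - m) : ℝ) : ℂ) ^ 2 / 2) ∂P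
        = ((1 - t ^ 2 * v / 2 : ℝ) : ℂ) := by
      have : (fun ω => ((t * (X ω - m) : ℝ) : ℂ) ^ 2 / 2)
          = fun ω => ((t ^ 2 / 2 * (X ω - m) ^ 2 : ℝ) : ℂ) := by
        ext ω; push_cast; ring
      rw [integral_sub iT12 iT2, integral_add (integrable_const _) iT1,
        this, integral_complex_ofReal, integral_mul_const, integral_complex_ofReal,
        integral_const_mul, integral_const_mul, i1, i2]
      simp; ring
    have iT3 : Integrable (fun ω => 1 + ((t * (X ω - m) : ℝ) : ℂ) * Complex.I
        - ((t * (X ω - m) : ℝ) : ℂ) ^ 2 / 2) P := iT12.sub iT2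
    rw [← iT, ← integral_sub iE iT3]
    have bound : ∀ ω, ‖Complex.exp ((t * (X ω - m) : ℝ) * Complex.I)
        - (1 + ((t * (X ω - m) : ℝ) : ℂ) * Complex.I - ((t * (X ω - m) : ℝ) : ℂ) ^ 2 / 2)‖
        ≤ 4 * |t| ^ 3 * (3 * ε * (X ω - m) ^ 2
          + 8 * Set.indicator {ω | ε ≤ |X ω|} (fun _ => (1 : ℝ)) ω) := by
      intro ω
      refine (norm_cexp_mul_I_sub_taylor_two_le _).trans ?_
      rw [abs_mul, mul_pow, mul_assoc]
      gcongr
      have h2 : |X ω - m| ≤ 2 := (abs_sub _ _).trans (by linarith [hX1 ω])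
      -- On the tail event the cube is at most `2³ = 8`. Off it, `|X - m| ≤ ε + 2 ε`, which takes
      -- one power out of the cube.
      by_cases h : ε ≤ |X ω|
      · rw [Set.indicator_of_mem (by exact h)]
        have : |X ω - m| ^ 3 ≤ 2 ^ 3 := pow_le_pow_left₀ (abs_nonneg _) h2 3
        nlinarith [mul_nonneg hε.le (sq_nonneg (X ω - m))]
      · rw [Set.indicator_of_notMem (by exact h)]
        have h3 : |X ω - m| ≤ 3 * ε := by
          push Not at h
          exact (abs_sub _ _).trans (by linarith)
        rw [← sq_abs (X ω - m)]
        nlinarith [sq_nonneg |X ω - m|]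
    refine (norm_integral_le_of_norm_le ?_ (ae_of_all _ bound)).trans ?_
    · exact ((iXm.const_mul _).add (((integrable_const _).indicator hset).const_mul _)).const_mul _
    · rw [integral_const_mul, integral_add (iXm.const_mul _)
        (((integrable_const _).indicator hset).const_mul _), integral_const_mul, integral_const_mul,
        i2, integral_indicator_const _ hset]
      simp [hqdef]
  have key2 : ‖((1 - t ^ 2 * v / 2 : ℝ) : ℂ) - Complex.exp ((-(t ^ 2 * v / 2) : ℝ))‖
      ≤ t ^ 4 * (ε * v) := by
    rw [← Complex.ofReal_exp, ← Complex.ofReal_sub, Complex.norm_real, Real.norm_eq_abs, abs_sub_comm]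
    refine (abs_exp_neg_sub_le (by positivity)).trans ?_
    have : v * v ≤ 2 * ε * v := mul_le_mul_of_nonneg_right hv2 hv0
    have h4 : 0 ≤ t ^ 4 := by positivity
    calc (t ^ 2 * v / 2) ^ 2 = t ^ 4 * (v * v / 4) := by ring
      _ ≤ t ^ 4 * (ε * v) := by gcongr; nlinarith [mul_nonneg hε.le hv0]
  refine (norm_sub_le_norm_sub_add_norm_sub _ ((1 - t ^ 2 * v / 2 : ℝ) : ℂ) _).trans
    ((add_le_add key key2).trans ?_)
  have h3 : 0 ≤ |t| ^ 3 := by positivity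
  have h4 : 0 ≤ t ^ 4 := by positivity
  have h5 : 0 ≤ ε * v := by positivity
  nlinarith [mul_nonneg h3 h5, mul_nonneg h3 hq0, mul_nonneg h4 hq0]

end BoundedVariable

/-! ### Truncated logarithms -/

/-- The logarithm of a nonnegative variable, divided by `s` and truncated at absolute value `1`. -/
noncomputable def truncLog (s r : ℝ) : ℝ :=
  Set.indicator {r : ℝ | 0 < r ∧ |Real.log r| < s} (fun r => Real.log r / s) r

lemma measurableSet_truncLog (s : ℝ) : MeasurableSet {r : ℝ | 0 < r ∧ |Real.log r| < s} :=
  (measurableSet_lt measurable_const measurable_id).inter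
    (measurableSet_lt Real.measurable_log.abs measurable_const)

lemma measurable_truncLog (s : ℝ) : Measurable (truncLog s) :=
  (Real.measurable_log.div_const s).indicator (measurableSet_truncLog s)

lemma abs_truncLog_le {s : ℝ} (hs : 0 < s) (r : ℝ) : |truncLog s r| ≤ 1 := by
  unfold truncLog
  by_cases h : 0 < r ∧ |Real.log r| < s
  · rw [Set.indicator_of_mem (by exact h), abs_div, abs_of_pos hs, div_le_one hs]
    exact h.2.le
  · rw [Set.indicator_of_notMem (by exact h)]; simp

lemma integral_truncLog (ρ : Measure ℝ) (s : ℝ) : ∫ r, truncLog s r ∂ρ = truncLogMean ρ s / s := by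
  unfold truncLog truncLogMean
  rw [integral_indicator (measurableSet_truncLog s), integral_div]

lemma integral_truncLog_sq (ρ : Measure ℝ) (s : ℝ) :
    ∫ r, truncLog s r ^ 2 ∂ρ - (truncLogMean ρ s / s) ^ 2 = truncLogVar ρ s / s ^ 2 := by
  have : (fun r => truncLog s r ^ 2) = Set.indicator {r : ℝ | 0 < r ∧ |Real.log r| < s}
      (fun r => Real.log r ^ 2 / s ^ 2) := by
    ext r
    unfold truncLog
    by_cases h : 0 < r ∧ |Real.log r| < s
    · rw [Set.indicator_of_mem (by exact h), Set.indicator_of_mem (by exact h), div_pow]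
    · rw [Set.indicator_of_notMem (by exact h), Set.indicator_of_notMem (by exact h)]; simp
  rw [this, integral_indicator (measurableSet_truncLog s), integral_div]
  unfold truncLogVar
  ring

lemma norm_logChar_le (ρ : Measure ℝ) [IsProbabilityMeasure ρ] (t : ℝ) : ‖logChar ρ t‖ ≤ 1 := by
  refine (norm_integral_le_of_norm_le_const
    (ae_of_all _ fun r => (Complex.norm_exp_ofReal_mul_I _).le)).trans ?_
  simp [measureReal_le_one]

/-- Since `ε ≤ 1`, truncation at `s` changes the logarithm only on the event measured by `logTail ρ
(ε * s)`, which also contains the point `0` left out of `logChar`. There the integrands differ by at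
most `2`, whence the summand `2` in the constant. -/
lemma norm_logChar_mul_sub_exp_le (ρ : Measure ℝ) [IsProbabilityMeasure ρ]
    (hρ : ∀ᵐ r ∂ρ, 0 ≤ r) {s ε : ℝ} (hs : 0 < s) (hε : 0 < ε) (hε1 : ε ≤ 1)
    (hq : logTail ρ (ε * s) ≤ ε) (t : ℝ) :
    0 ≤ truncLogVar ρ s / s ^ 2 ∧
    ‖logChar ρ (t / s) * Complex.exp ((-(t * (truncLogMean ρ s / s)) : ℝ) * Complex.I)
        - Complex.exp ((-(t ^ 2 * (truncLogVar ρ s / s ^ 2) / 2) : ℝ))‖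
      ≤ (32 * |t| ^ 3 + t ^ 4 + 2) * (ε * (truncLogVar ρ s / s ^ 2) + logTail ρ (ε * s)) := by
  set m := truncLogMean ρ s / s
  set v := truncLogVar ρ s / s ^ 2
  -- Where the truncation is active, `truncLog` is `0`, which is below `ε`.
  have hsub : {r | ε ≤ |truncLog s r|} ⊆ {r : ℝ | r = 0 ∨ ε * s ≤ |Real.log r|} := by
    intro r hr
    simp only [Set.mem_ofPred_eq, truncLog] at hr
    by_cases h : 0 < r ∧ |Real.log r| < s
    · rw [Set.indicator_of_mem (by exact h), abs_div, abs_of_pos hs, le_div_iff₀ hs] at hr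
      exact Or.inr hr
    · rw [Set.indicator_of_notMem (by exact h), abs_zero] at hr
      linarith
  have hq1 : ρ.real {r | ε ≤ |truncLog s r|} ≤ logTail ρ (ε * s) := measureReal_mono hsub
  obtain ⟨hv0, hmain⟩ := norm_integral_cexp_sub_exp_le (P := ρ) (measurable_truncLog s)
    (abs_truncLog_le hs) hε (hq1.trans hq) t (m := m) (v := v) (integral_truncLog ρ s).symm
    (integral_truncLog_sq ρ s).symm
  refine ⟨hv0, ?_⟩
  set A := {r : ℝ | r = 0 ∨ ε * s ≤ |Real.log r|}
  have hA : MeasurableSet A := (measurableSet_singleton 0).union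
    (measurableSet_le measurable_const Real.measurable_log.abs)
  have hdiff : ‖logChar ρ (t / s) * Complex.exp ((-(t * m) : ℝ) * Complex.I)
      - ∫ r, Complex.exp ((t * (truncLog s r - m) : ℝ) * Complex.I) ∂ρ‖ ≤ 2 * logTail ρ (ε * s) := by
    have i1 : Integrable (fun r => Set.indicator (Set.Ioi 0)
        (fun r => Complex.exp ((t / s * Real.log r : ℝ) * Complex.I)
          * Complex.exp ((-(t * m) : ℝ) * Complex.I)) r) ρ := by
      refine Integrable.indicator (Integrable.of_bound ?_ 1 (ae_of_all _ fun r => ?_))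
        measurableSet_Ioi
      · exact Measurable.aestronglyMeasurable (by fun_prop)
      · rw [norm_mul, Complex.norm_exp_ofReal_mul_I, Complex.norm_exp_ofReal_mul_I, mul_one]
    have i2 : Integrable (fun r => Complex.exp ((t * (truncLog s r - m) : ℝ) * Complex.I)) ρ := by
      refine Integrable.of_bound ?_ 1 (ae_of_all _ fun r => (Complex.norm_exp_ofReal_mul_I _).le)
      have := measurable_truncLog s
      exact Measurable.aestronglyMeasurable (by fun_prop)
    rw [logChar, ← integral_mul_const, ← integral_indicator measurableSet_Ioi, ← integral_sub i1 i2]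
    have hb : ∀ᵐ r ∂ρ, ‖Set.indicator (Set.Ioi 0)
        (fun r => Complex.exp ((t / s * Real.log r : ℝ) * Complex.I)
          * Complex.exp ((-(t * m) : ℝ) * Complex.I)) r
          - Complex.exp ((t * (truncLog s r - m) : ℝ) * Complex.I)‖
        ≤ Set.indicator A (fun _ => (2 : ℝ)) r := by
      filter_upwards [hρ] with r hr
      by_cases h : r ∈ A
      · rw [Set.indicator_of_mem h]
        refine (norm_sub_le _ _).trans ?_
        rw [Complex.norm_exp_ofReal_mul_I]
        have : ‖Set.indicator (Set.Ioi 0) (fun r => Complex.exp ((t / s * Real.log r : ℝ) * Complex.I)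
            * Complex.exp ((-(t * m) : ℝ) * Complex.I)) r‖ ≤ 1 := by
          refine (norm_indicator_le_norm_self _ _).trans ?_
          rw [norm_mul, Complex.norm_exp_ofReal_mul_I, Complex.norm_exp_ofReal_mul_I, mul_one]
        linarith
      · rw [Set.indicator_of_notMem h]
        have h' : ¬ (r = 0 ∨ ε * s ≤ |Real.log r|) := h
        push Not at h'
        have hr0 : 0 < r := lt_of_le_of_ne hr (Ne.symm h'.1)
        have hlt : |Real.log r| < s := h'.2.trans_le (mul_le_of_le_one_left hs.le hε1)
        rw [Set.indicator_of_mem (by exact hr0), truncLog,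
          Set.indicator_of_mem (by exact ⟨hr0, hlt⟩), ← Complex.exp_add]
        rw [sub_eq_zero.2, norm_zero]
        congr 1
        push_cast
        field_simp
        ring
    refine (norm_integral_le_of_norm_le ((integrable_const _).indicator hA) hb).trans ?_
    rw [integral_indicator_const _ hA, smul_eq_mul, mul_comm]
    rfl
  have ht0 : 0 ≤ logTail ρ (ε * s) := measureReal_nonneg
  have h3 : 0 ≤ |t| ^ 3 := by positivity
  have h4 : 0 ≤ t ^ 4 := by positivity
  have h5 : 0 ≤ ε * v := mul_nonneg hε.le hv0
  refine (norm_sub_le_norm_sub_add_norm_sub _ _ _).trans ((add_le_add hdiff hmain).trans ?_)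
  have h6 : (32 * |t| ^ 3 + t ^ 4) * (ε * v + ρ.real {r | ε ≤ |truncLog s r|})
      ≤ (32 * |t| ^ 3 + t ^ 4) * (ε * v + logTail ρ (ε * s)) := by gcongr
  linarith

/-! ### Simplex volume and Gram determinants -/

lemma measurableSet_cornerSet (p : ℕ) (c : ℝ) :
    MeasurableSet {s : Fin p → ℝ | (∀ i, 0 ≤ s i) ∧ ∑ i, s i ≤ c} :=
  (MeasurableSet.congr (MeasurableSet.iInter fun i : Fin p =>
    measurableSet_le (measurable_const (a := (0 : ℝ))) (measurable_pi_apply i))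
    (by ext; simp only [Set.mem_iInter]; rfl)).inter
    (measurableSet_le (Finset.measurable_sum _ fun i _ => measurable_pi_apply i) measurable_const)

/-- Slicing at first coordinate `x` gives a corner of size `c - x` one dimension lower; this is why
`c` is general in the induction. -/
lemma volume_cornerSet (p : ℕ) {c : ℝ} (hc : 0 ≤ c) :
    volume {s : Fin p → ℝ | (∀ i, 0 ≤ s i) ∧ ∑ i, s i ≤ c}
      = ENNReal.ofReal (c ^ p / (p ! : ℝ)) := by
  induction p generalizing c with
  | zero =>
    have : {s : Fin 0 → ℝ | (∀ i, 0 ≤ s i) ∧ ∑ i, s i ≤ c} = Set.univ := by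
      ext; simp [hc]
    rw [this]
    simp [volume_pi]
  | succ p ih =>
    have hmp := (volume_preserving_piFinSuccAbove (fun _ : Fin (p + 1) => ℝ) 0).symm
    rw [← hmp.measure_preimage (measurableSet_cornerSet _ c).nullMeasurableSet]
    rw [Measure.volume_eq_prod, Measure.prod_apply (hmp.measurable (measurableSet_cornerSet _ c))]
    have : ∀ x : ℝ, volume (Prod.mk x ⁻¹' ((MeasurableEquiv.piFinSuccAbove (fun _ : Fin (p + 1) => ℝ) 0).symm ⁻¹'
          {s : Fin (p + 1) → ℝ | (∀ i, 0 ≤ s i) ∧ ∑ i, s i ≤ c}))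
        = Set.indicator (Set.Icc 0 c) (fun x => ENNReal.ofReal ((c - x) ^ p / (p ! : ℝ))) x := by
      intro x
      have e : (Prod.mk x ⁻¹' ((MeasurableEquiv.piFinSuccAbove (fun _ : Fin (p + 1) => ℝ) 0).symm ⁻¹'
          {s : Fin (p + 1) → ℝ | (∀ i, 0 ≤ s i) ∧ ∑ i, s i ≤ c}))
          = {s : Fin p → ℝ | 0 ≤ x ∧ (∀ i, 0 ≤ s i) ∧ ∑ i, s i ≤ c - x} := by
        ext s
        simp [MeasurableEquiv.piFinSuccAbove_symm_apply, Fin.insertNthEquiv, Fin.forall_fin_succ,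
          Fin.sum_univ_succ, and_assoc, le_sub_iff_add_le, add_comm]
      rw [e]
      by_cases hx : x ∈ Set.Icc 0 c
      · rw [Set.indicator_of_mem hx, ← ih (sub_nonneg.2 hx.2)]
        simp [hx.1]
      · rw [Set.indicator_of_notMem hx]
        convert measure_empty (μ := volume)
        ext s
        simp only [Set.mem_ofPred_eq, Set.mem_empty_iff_false, iff_false]
        rintro ⟨h0, h1, h2⟩
        have := Finset.sum_nonneg fun i (_ : i ∈ Finset.univ) => h1 i
        exact hx ⟨h0, by linarith⟩
    simp_rw [this]
    rw [lintegral_indicator measurableSet_Icc, ← ofReal_integral_eq_lintegral_ofReal]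
    · congr 1
      rw [integral_Icc_eq_integral_Ioc, ← intervalIntegral.integral_of_le hc,
        intervalIntegral.integral_div,
        intervalIntegral.integral_comp_sub_left (fun x => x ^ p) c]
      simp [Nat.factorial_succ]
      field_simp
    · exact (Continuous.integrableOn_Icc (by fun_prop))
    · refine (ae_restrict_iff' measurableSet_Icc).2 (ae_of_all _ fun x hx => ?_)
      have := sub_nonneg.2 hx.2
      positivity

/-- The simplex is the image of the standard corner, of volume `1 / p!`, under the linear map
sending the basis to `y`, whose volume factor is the root of the Gram determinant. -/
lemma simplexVolume_eq {n p : ℕ} (y : Fin p → EuclideanSpace ℝ (Fin n)) :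
    simplexVolume y = √(Matrix.gram ℝ y).det / (p ! : ℝ) := by
  let f : EuclideanSpace ℝ (Fin p) →ₗ[ℝ] EuclideanSpace ℝ (Fin n) :=
    (EuclideanSpace.basisFun (Fin p) ℝ).toBasis.constr ℝ y
  have hfb : ∀ i, f (EuclideanSpace.basisFun (Fin p) ℝ i) = y i := fun i => by
    rw [← OrthonormalBasis.coe_toBasis]
    exact (EuclideanSpace.basisFun (Fin p) ℝ).toBasis.constr_basis ℝ y i
  have hf : ∀ s, f s = ∑ i, s i • y i := fun s => by
    simp [f, Module.Basis.constr_apply_fintype]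
  have himg : cornerSimplex y = f '' (WithLp.ofLp ⁻¹' {s : Fin p → ℝ | (∀ i, 0 ≤ s i) ∧ ∑ i, s i ≤ 1}) := by
    ext x
    simp only [cornerSimplex, Set.mem_ofPred_eq, Set.mem_image, Set.mem_preimage]
    constructor
    · rintro ⟨s, h0, h1, rfl⟩
      exact ⟨WithLp.toLp 2 s, ⟨h0, h1⟩, by simp [hf]⟩
    · rintro ⟨s, ⟨h0, h1⟩, rfl⟩
      exact ⟨s, h0, h1, hf s⟩
  have hv := f.euclideanHausdorffMeasure_image_eq_normDet_mul_volume
    (WithLp.ofLp ⁻¹' {s : Fin p → ℝ | (∀ i, 0 ≤ s i) ∧ ∑ i, s i ≤ 1})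
  rw [finrank_euclideanSpace_fin, ← himg,
    (PiLp.volume_preserving_ofLp (Fin p)).measure_preimage
      (measurableSet_cornerSet p 1).nullMeasurableSet] at hv
  have hdet : f.normDet = √(Matrix.gram ℝ y).det := by
    have h := f.normDet_sq_eq_det_gram (EuclideanSpace.basisFun (Fin p) ℝ)
    simp_rw [hfb] at h
    rw [← h]
    simp [Real.sqrt_sq f.normDet_nonneg]
  rw [simplexVolume, hv, volume_cornerSet p zero_le_one, hdet, ENNReal.toReal_mul,
    ENNReal.toReal_ofReal (Real.sqrt_nonneg _), ENNReal.toReal_ofReal (by positivity)]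
  simp [div_eq_mul_inv]

/-- Base times height: `x` differs from its component `u` orthogonal to the span by a combination of
the `y i`, so row and column operations replace `x` by `u`. The first row then vanishes off the
diagonal. -/
lemma det_gram_cons {E : Type*} [NormedAddCommGroup E] [InnerProductSpace ℝ E]
    [FiniteDimensional ℝ E] {k : ℕ} (x : E) (y : Fin k → E) :
    (Matrix.gram ℝ (Fin.cons x y : Fin (k + 1) → E)).det
      = ‖(Submodule.span ℝ (Set.range y))ᗮ.orthogonalProjectionOnto x‖ ^ 2 * (Matrix.gram ℝ y).det := by
  set W := Submodule.span ℝ (Set.range y)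
  set u : E := (Wᗮ.orthogonalProjectionOnto x : E) with hu
  have hxu : x - u ∈ W := by
    simp [hu]
  obtain ⟨a, ha⟩ := (Submodule.mem_span_range_iff_exists_fun ℝ).1 hxu
  have huy : ∀ i, inner ℝ u (y i) = 0 := fun i =>
    (Submodule.mem_orthogonal' _ _).1 (Wᗮ.orthogonalProjectionOnto x).2 _
      (Submodule.subset_span ⟨i, rfl⟩)
  let c : Fin (k + 1) → ℝ := Fin.cons 1 a
  have hx : x = ∑ i, c i • (Fin.cons u y : Fin (k + 1) → E) i := by
    rw [Fin.sum_univ_succ]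
    simp [c, ha]
  -- Intermediate matrix, with `u` already in the rows and `x` still in the columns.
  let A : Matrix (Fin (k + 1)) (Fin (k + 1)) ℝ := Matrix.of fun i j =>
    inner ℝ ((Fin.cons u y : Fin (k + 1) → E) i) ((Fin.cons x y : Fin (k + 1) → E) j)
  have hA1 : Matrix.gram ℝ (Fin.cons x y : Fin (k + 1) → E) = A.updateRow 0 (∑ i, c i • A i) := by
    ext i j
    refine Fin.cases ?_ (fun i => ?_) i
    · simp only [Matrix.gram_apply, Fin.cons_zero, Matrix.updateRow_self, Finset.sum_apply,
        Pi.smul_apply, A, Matrix.of_apply, smul_eq_mul]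
      have := congrArg (fun z => inner ℝ z ((Fin.cons x y : Fin (k + 1) → E) j)) hx
      simpa only [sum_inner, real_inner_smul_left] using this
    · simp [A]
  have hA2 : A = (Matrix.gram ℝ (Fin.cons u y : Fin (k + 1) → E)).updateCol 0
      (fun j => ∑ i, c i • Matrix.gram ℝ (Fin.cons u y : Fin (k + 1) → E) j i) := by
    ext i j
    refine Fin.cases ?_ (fun j => ?_) j
    · simp only [Matrix.gram_apply, Fin.cons_zero, Matrix.updateCol_self, A, Matrix.of_apply,
        smul_eq_mul]
      conv_lhs => rw [hx, inner_sum]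
      simp_rw [real_inner_smul_right]
    · simp [A]
  have h1 : (Matrix.gram ℝ (Fin.cons x y : Fin (k + 1) → E)).det
      = (Matrix.gram ℝ (Fin.cons u y : Fin (k + 1) → E)).det := by
    rw [hA1, Matrix.det_updateRow_sum, hA2, Matrix.det_updateCol_sum]
    simp [c]
  have h2 : ∀ i : Fin k, Matrix.gram ℝ (Fin.cons u y : Fin (k + 1) → E) 0 i.succ = 0 := fun i => by
    simp [huy]
  have h3 : (Matrix.gram ℝ (Fin.cons u y : Fin (k + 1) → E)).submatrix Fin.succ Fin.succ
      = Matrix.gram ℝ y := by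
    ext i j; simp
  rw [h1, Matrix.det_succ_row_zero, Fin.sum_univ_succ]
  simp only [h2, Fin.succAbove_zero, h3]
  simp only [Fin.val_zero, pow_zero, Matrix.gram_apply, Fin.cons_zero, real_inner_self_eq_norm_sq,
    mul_zero, zero_mul, Finset.sum_const_zero, add_zero, one_mul]
  rfl

/-! ### The squared norm of a Gaussian vector -/

section Gaussian

variable {E : Type*} [NormedAddCommGroup E] [InnerProductSpace ℝ E] [FiniteDimensional ℝ E]
  [MeasurableSpace E] [BorelSpace E]

lemma stdGaussian_eq_withDensity :
    stdGaussian E = (volume : Measure E).withDensity fun x => ENNReal.ofReal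
      (((2 * Real.pi) ^ (Module.finrank ℝ E / 2 : ℝ))⁻¹ * Real.exp (-(1 / 2) * ‖x‖ ^ 2)) := by
  set Z : ℝ := (2 * Real.pi) ^ (Module.finrank ℝ E / 2 : ℝ) with hZ
  have hZ0 : 0 < Z := by positivity
  have hint : ∫ x : E, Real.exp (-(1 / 2) * ‖x‖ ^ 2) = Z := by
    rw [GaussianFourier.integral_rexp_neg_mul_sq_norm (by norm_num : (0 : ℝ) < 1 / 2)]
    rw [hZ]; congr 1; ring
  -- A nonintegrable function would have integral `0` by convention, while this one has integral `Z
  -- > 0`.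
  have hi : Integrable (fun x : E => Real.exp (-(1 / 2) * ‖x‖ ^ 2)) := by
    by_contra h
    rw [integral_undef h] at hint
    exact hZ0.ne hint
  have hm : Measurable fun x : E => ENNReal.ofReal (Z⁻¹ * Real.exp (-(1 / 2) * ‖x‖ ^ 2)) := by
    fun_prop
  have : IsFiniteMeasure ((volume : Measure E).withDensity fun x => ENNReal.ofReal
      (Z⁻¹ * Real.exp (-(1 / 2) * ‖x‖ ^ 2))) := isFiniteMeasure_withDensity_ofReal (hi.const_mul _).2
  refine Measure.ext_of_charFun (funext fun t => ?_)
  rw [charFun_stdGaussian, charFun_apply,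
    integral_withDensity_eq_integral_toReal_smul hm (ae_of_all _ fun _ => ENNReal.ofReal_lt_top)]
  have h2 := GaussianFourier.integral_cexp_neg_mul_sq_norm_add (V := E) (b := 1 / 2) (by norm_num)
    Complex.I t
  have e : ∀ x : E, (ENNReal.ofReal (Z⁻¹ * Real.exp (-(1 / 2) * ‖x‖ ^ 2))).toReal
      • Complex.exp ((inner ℝ x t : ℝ) * Complex.I)
      = ((Z⁻¹ : ℝ) : ℂ) * Complex.exp (-(1 / 2) * (‖x‖ : ℂ) ^ 2 + Complex.I * (inner ℝ t x : ℝ)) := by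
    intro x
    rw [ENNReal.toReal_ofReal (by positivity), Complex.exp_add, real_inner_comm, Complex.real_smul]
    push_cast
    rw [mul_comm Complex.I]; ring
  simp_rw [e]
  rw [integral_const_mul, h2]
  have hZc : ((Real.pi : ℂ) / (1 / 2)) ^ (Module.finrank ℝ E / 2 : ℂ) = (Z : ℂ) := by
    rw [hZ, Complex.ofReal_cpow (by positivity)]
    push_cast
    congr 1; ring
  rw [hZc, ← mul_assoc, ← Complex.ofReal_mul, inv_mul_cancel₀ hZ0.ne', Complex.ofReal_one, one_mul]
  congr 1
  rw [Complex.I_sq]; ring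

/-- The characteristic function of `log ‖X‖²` for a standard Gaussian vector `X` in dimension
`m`. -/
noncomputable def gaussLogChar (m : ℕ) (t : ℝ) : ℂ :=
  2 ^ (t * Complex.I) * Complex.Gamma (m / 2 + t * Complex.I) / Complex.Gamma (m / 2)

lemma gaussLogChar_ne_zero {m : ℕ} (hm : 0 < m) (t : ℝ) : gaussLogChar m t ≠ 0 := by
  have hm' : (0 : ℝ) < m := by exact_mod_cast hm
  refine div_ne_zero (mul_ne_zero ?_ ?_) ?_
  · rw [Complex.cpow_def_of_ne_zero two_ne_zero]
    exact Complex.exp_ne_zero _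
  · exact Complex.Gamma_ne_zero_of_re_pos (by simp [hm'])
  · exact Complex.Gamma_ne_zero_of_re_pos (by simp [hm'])

/-- The substitution `s = r ^ 2` turns this into a Gamma integral with complex exponent. -/
lemma integral_radial_gaussian {m : ℕ} (hm : 0 < m) (t : ℝ) :
    ∫ r in Set.Ioi (0 : ℝ), r ^ (m - 1) • ((Real.exp (-(1 / 2) * r ^ 2) : ℝ)
        * Complex.exp ((t * Real.log (r ^ 2) : ℝ) * Complex.I))
      = 1 / 2 * (2 ^ (m / 2 + t * Complex.I : ℂ) * Complex.Gamma (m / 2 + t * Complex.I)) := by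
  have hm' : (0 : ℝ) < m := by exact_mod_cast hm
  have h := Complex.integral_cpow_mul_exp_neg_mul_Ioi (a := m / 2 + t * Complex.I) (r := 1 / 2)
    (by simp [hm']) (by norm_num)
  have h2 : (1 : ℂ) / ((1 / 2 : ℝ) : ℂ) = 2 := by push_cast; norm_num
  rw [h2] at h
  rw [← h, ← integral_comp_rpow_Ioi_of_pos (g := fun r : ℝ => (r : ℂ) ^ (m / 2 + t * Complex.I - 1 : ℂ)
    * Complex.exp (-((1 / 2 : ℝ) * r))) (p := 2) (by norm_num), ← integral_const_mul]
  refine setIntegral_congr_fun measurableSet_Ioi fun r (hr : 0 < r) => ?_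
  have hr' : (r : ℂ) ≠ 0 := by exact_mod_cast hr.ne'
  have e1 : (r : ℝ) ^ (2 : ℝ) = r ^ 2 := by norm_cast
  have e2 : ((r ^ 2 : ℝ) : ℂ) ^ (m / 2 + t * Complex.I - 1 : ℂ) * r
      = (r : ℂ) ^ (m - 1) * Complex.exp ((t * Real.log (r ^ 2) : ℝ) * Complex.I) := by
    have hpow : (r : ℂ) ^ (m - 1) = Complex.exp (((m : ℂ) - 1) * Real.log r) := by
      rw [← Complex.cpow_natCast, Complex.cpow_def_of_ne_zero hr', Complex.ofReal_log hr.le, mul_comm,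
        Nat.cast_sub hm, Nat.cast_one]
    have hr1 : (r : ℂ) = Complex.exp (Real.log r) := by
      rw [Complex.ofReal_log hr.le, Complex.exp_log hr']
    rw [Complex.cpow_def_of_ne_zero (by exact_mod_cast (pow_pos hr 2).ne'), hpow,
      ← Complex.ofReal_log (by positivity), Real.log_pow]
    conv_lhs => rw [hr1]
    rw [← Complex.exp_add, ← Complex.exp_add]
    congr 1
    push_cast
    ring
  simp only [e1, Complex.real_smul]
  have e3 : (2 : ℝ) - 1 = 1 := by norm_num
  rw [e3, Real.rpow_one]
  push_cast at e2 ⊢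
  rw [show (1 : ℂ) / 2 * (2 * (r : ℂ) * (((r : ℂ) ^ 2) ^ (m / 2 + t * Complex.I - 1 : ℂ)
      * Complex.exp (-(1 / 2 * (r : ℂ) ^ 2))))
      = (((r : ℂ) ^ 2) ^ (m / 2 + t * Complex.I - 1 : ℂ) * r) * Complex.exp (-(1 / 2 * (r : ℂ) ^ 2))
      by ring, e2]
  rw [show -(1 / 2) * (r : ℂ) ^ 2 = -(1 / 2 * (r : ℂ) ^ 2) by ring]
  ring

lemma integral_cexp_log_norm_sq_stdGaussian (hE : 0 < Module.finrank ℝ E) (t : ℝ) :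
    ∫ x, Complex.exp ((t * Real.log (‖x‖ ^ 2) : ℝ) * Complex.I) ∂(stdGaussian E)
      = gaussLogChar (Module.finrank ℝ E) t := by
  have : Nontrivial E := Module.nontrivial_of_finrank_pos hE
  set m := Module.finrank ℝ E with hmdef
  -- Polar coordinates give a constant independent of `t`. Its value is fixed by `t = 0`, where the
  -- left side is `1`, so the volume of the unit ball need not be known.
  obtain ⟨K, hK⟩ : ∃ K : ℂ, ∀ t : ℝ,
      ∫ x, Complex.exp ((t * Real.log (‖x‖ ^ 2) : ℝ) * Complex.I) ∂(stdGaussian E)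
        = K * (2 ^ (m / 2 + t * Complex.I : ℂ) * Complex.Gamma (m / 2 + t * Complex.I)) := by
    refine ⟨(((2 * Real.pi) ^ (m / 2 : ℝ))⁻¹ : ℝ) * (m * ((volume : Measure E).real (Metric.ball 0 1) * (1 / 2))), fun t => ?_⟩
    rw [stdGaussian_eq_withDensity, ← hmdef,
      integral_withDensity_eq_integral_toReal_smul (by fun_prop)
        (ae_of_all _ fun _ => ENNReal.ofReal_lt_top)]
    have e : ∀ x : E, (ENNReal.ofReal (((2 * Real.pi) ^ (m / 2 : ℝ))⁻¹
        * Real.exp (-(1 / 2) * ‖x‖ ^ 2))).toReal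
        • Complex.exp ((t * Real.log (‖x‖ ^ 2) : ℝ) * Complex.I)
        = ((((2 * Real.pi) ^ (m / 2 : ℝ))⁻¹ : ℝ) : ℂ) * ((Real.exp (-(1 / 2) * ‖x‖ ^ 2) : ℝ)
        * Complex.exp ((t * Real.log (‖x‖ ^ 2) : ℝ) * Complex.I)) := by
      intro x
      rw [ENNReal.toReal_ofReal (by positivity), Complex.real_smul]
      push_cast; ring
    simp_rw [e]
    rw [integral_const_mul, integral_fun_norm_addHaar volume (fun r : ℝ =>
      ((Real.exp (-(1 / 2) * r ^ 2) : ℝ) : ℂ) * Complex.exp ((t * Real.log (r ^ 2) : ℝ) * Complex.I)),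
      ← hmdef, integral_radial_gaussian hE]
    simp only [nsmul_eq_mul, Complex.real_smul]
    push_cast; ring
  have h0 := hK 0
  have hm' : (0 : ℝ) < m := by exact_mod_cast hE
  have hG : Complex.Gamma (m / 2) ≠ 0 := Complex.Gamma_ne_zero_of_re_pos (by simp [hm'])
  simp only [zero_mul, Complex.ofReal_zero, Complex.exp_zero, add_zero] at h0
  simp only [integral_const, probReal_univ, one_smul] at h0
  rw [hK t, gaussLogChar, Complex.cpow_add _ _ two_ne_zero, eq_div_iff hG]
  linear_combination (-(2 ^ (t * Complex.I : ℂ) * Complex.Gamma (m / 2 + t * Complex.I))) * h0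

end Gaussian

/-! ### The logarithm of a beta variable -/

lemma logChar_betaMeasure {a b : ℝ} (ha : 0 < a) (hb : 0 < b) (t : ℝ) :
    logChar (betaMeasure a b) t
      = Complex.Gamma (a + t * Complex.I) * Complex.Gamma (a + b)
        / (Complex.Gamma a * Complex.Gamma (a + b + t * Complex.I)) := by
  have key : logChar (betaMeasure a b) t
      = (1 / beta a b : ℝ) * Complex.betaIntegral (a + t * Complex.I) b := by
    rw [logChar, betaMeasure, restrict_withDensity measurableSet_Ioi,
      integral_withDensity_eq_integral_toReal_smul (f := betaPDF a b)
        (measurable_betaPDFReal a b).ennreal_ofReal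
      (ae_of_all _ fun _ => ENNReal.ofReal_lt_top), Complex.betaIntegral,
      intervalIntegral.integral_of_le zero_le_one, integral_Ioc_eq_integral_Ioo,
      ← integral_const_mul, setIntegral_eq_of_subset_of_forall_sdiff_eq_zero measurableSet_Ioi
        Set.Ioo_subset_Ioi_self]
    · refine setIntegral_congr_fun measurableSet_Ioo fun r hr => ?_
      have h0 : 0 < r := hr.1
      have h1 : 0 < 1 - r := sub_pos.2 hr.2
      have hB := beta_pos ha hb
      have hr' : (r : ℂ) ≠ 0 := by exact_mod_cast h0.ne'
      simp only [betaPDF_of_pos_lt_one hr.1 hr.2]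
      rw [ENNReal.toReal_ofReal (by positivity), Complex.real_smul,
        show (a : ℂ) + t * Complex.I - 1 = ((a - 1 : ℝ) : ℂ) + t * Complex.I by push_cast; ring,
        Complex.cpow_add _ _ hr', ← Complex.ofReal_cpow h0.le,
        Complex.cpow_def_of_ne_zero hr' (t * Complex.I), ← Complex.ofReal_log h0.le,
        show (1 : ℂ) - r = ((1 - r : ℝ) : ℂ) by push_cast; ring,
        show (b : ℂ) - 1 = ((b - 1 : ℝ) : ℂ) by push_cast; ring, ← Complex.ofReal_cpow h1.le,
        show ((t * Real.log r : ℝ) : ℂ) * Complex.I = Real.log r * (t * Complex.I) by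
          push_cast; ring]
      push_cast
      ring
    · rintro r ⟨h0, h1⟩
      rw [betaPDF_eq_zero_of_one_le (not_lt.1 fun h => h1 ⟨h0, h⟩)]
      simp
  have ga : Complex.Gamma a ≠ 0 := Complex.Gamma_ne_zero_of_re_pos (by simpa)
  have gb : Complex.Gamma b ≠ 0 := Complex.Gamma_ne_zero_of_re_pos (by simpa)
  have gab : Complex.Gamma (a + b) ≠ 0 :=
    Complex.Gamma_ne_zero_of_re_pos (by simpa using add_pos ha hb)
  have gt : Complex.Gamma (a + b + t * Complex.I) ≠ 0 :=
    Complex.Gamma_ne_zero_of_re_pos (by simpa using add_pos ha hb)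
  rw [key, Complex.betaIntegral_eq_Gamma_mul_div _ _ (by simpa) (by simpa), beta]
  push_cast
  rw [← Complex.Gamma_ofReal, ← Complex.Gamma_ofReal, ← Complex.Gamma_ofReal]
  push_cast
  rw [show (a : ℂ) + t * Complex.I + b = a + b + t * Complex.I by ring]
  field_simp

/-- Here `a + b = n / 2`, and the powers of `2` in the two Gaussian factors cancel. -/
lemma logChar_betaLaw {n j : ℕ} (hj : 0 < j) (hjn : j < n) (t : ℝ) :
    logChar (betaLaw n j) t = gaussLogChar (n - j) t / gaussLogChar n t := by
  have hj' : (0 : ℝ) < j := by exact_mod_cast hj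
  have hjn' : (j : ℝ) < n := by exact_mod_cast hjn
  have hn : (0 : ℝ) < n := hj'.trans hjn'
  rw [betaLaw, logChar_betaMeasure (by linarith) (by linarith), gaussLogChar, gaussLogChar,
    Nat.cast_sub hjn.le]
  have h2 : (2 : ℂ) ^ (t * Complex.I) ≠ 0 := by
    rw [Complex.cpow_def_of_ne_zero two_ne_zero]
    exact Complex.exp_ne_zero _
  have g1 : Complex.Gamma (((n : ℂ) - j) / 2) ≠ 0 :=
    Complex.Gamma_ne_zero_of_re_pos (by simp [hjn'])
  have g2 : Complex.Gamma ((n : ℂ) / 2) ≠ 0 := Complex.Gamma_ne_zero_of_re_pos (by simp [hn])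
  have g3 : Complex.Gamma ((n : ℂ) / 2 + t * Complex.I) ≠ 0 :=
    Complex.Gamma_ne_zero_of_re_pos (by simp [hn])
  push_cast
  rw [show ((n : ℂ) - j) / 2 + j / 2 = n / 2 by ring]
  field_simp

/-! ### Rotation invariant laws and their projections -/

section Rotation

variable {E : Type*} [NormedAddCommGroup E] [InnerProductSpace ℝ E] [FiniteDimensional ℝ E]
  [MeasurableSpace E] [BorelSpace E]

/-- The reflection in the hyperplane orthogonal to `s - t` sends `s` to `t`. -/
lemma charFun_eq_of_norm_eq {ν : Measure E} (hν : ∀ T : E ≃ₗᵢ[ℝ] E, ν.map T = ν) {s t : E}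
    (h : ‖s‖ = ‖t‖) : charFun ν s = charFun ν t := by
  set T := (ℝ ∙ (s - t))ᗮ.reflection
  have hT : T s = t := Submodule.reflection_sub h
  conv_rhs => rw [← hν T, charFun_apply, integral_map (by fun_prop) (by fun_prop)]
  rw [charFun_apply, ← hT]
  simp_rw [LinearIsometryEquiv.inner_map_map]

/-- Independence of norm and direction, by comparing characteristic functions. -/
lemma eq_map_norm_smul {ν μ : Measure E} [IsFiniteMeasure ν] [IsProbabilityMeasure μ]
    (hν : ∀ T : E ≃ₗᵢ[ℝ] E, ν.map T = ν) (hμ : ∀ T : E ≃ₗᵢ[ℝ] E, μ.map T = μ)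
    (hμ1 : ∀ᵐ u ∂μ, ‖u‖ = 1) :
    ν = (ν.prod μ).map fun p => ‖p.1‖ • p.2 := by
  refine Measure.ext_of_charFun (funext fun t => ?_)
  have hm : Measurable fun p : E × E => ‖p.1‖ • p.2 := by fun_prop
  conv_rhs => rw [charFun_apply, integral_map hm.aemeasurable (by fun_prop)]
  have hint : ∀ f : E × E → ℝ, Measurable f →
      Integrable (fun p => Complex.exp (f p * Complex.I)) (ν.prod μ) := fun f hf =>
    Integrable.of_bound (Measurable.aestronglyMeasurable (by fun_prop)) 1
      (ae_of_all _ fun p => (Complex.norm_exp_ofReal_mul_I _).le)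
  rw [integral_prod _ (hint _ (by fun_prop))]
  -- The vectors `‖y‖ • t` and `‖t‖ • y` have equal norms, so invariance of `μ` moves the random
  -- norm from `y` to `t`. After Fubini, the integral over `y` is `charFun ν` at a vector of norm
  -- `‖t‖`.
  have h1 : ∀ y : E, ∫ u, Complex.exp ((inner ℝ (‖y‖ • u) t : ℝ) * Complex.I) ∂μ
      = ∫ u, Complex.exp ((inner ℝ y (‖t‖ • u) : ℝ) * Complex.I) ∂μ := by
    intro y
    have := charFun_eq_of_norm_eq hμ (s := ‖y‖ • t) (t := ‖t‖ • y) (by simp [norm_smul, mul_comm])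
    rw [charFun_apply, charFun_apply] at this
    simpa [real_inner_smul_left, real_inner_smul_right, real_inner_comm] using this
  simp_rw [h1]
  rw [integral_integral_swap (hint (fun p => inner ℝ p.1 (‖t‖ • p.2)) (by fun_prop))]
  have h2 : ∀ᵐ u ∂μ, ∫ y, Complex.exp ((inner ℝ y (‖t‖ • u) : ℝ) * Complex.I) ∂ν = charFun ν t := by
    filter_upwards [hμ1] with u hu
    exact charFun_eq_of_norm_eq hν (by simp [norm_smul, hu])
  rw [integral_congr_ae h2]
  simp

lemma stdGaussian_singleton_zero (hE : 0 < Module.finrank ℝ E) : stdGaussian E {0} = 0 := by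
  have : Nontrivial E := Module.nontrivial_of_finrank_pos hE
  rw [stdGaussian_eq_withDensity]
  exact withDensity_absolutelyContinuous _ _ (measure_singleton 0)

lemma map_orthogonalProjectionOnto_stdGaussian (U : Submodule ℝ E) :
    (stdGaussian E).map U.orthogonalProjectionOnto = stdGaussian U := by
  refine Measure.ext_of_charFun (funext fun t => ?_)
  rw [charFun_apply, integral_map (by fun_prop) (by fun_prop), charFun_stdGaussian]
  have : ∀ x : E, inner ℝ (U.orthogonalProjectionOnto x) t = inner ℝ x (t : E) := fun x => by
    simp
  simp_rw [this, ← charFun_apply, charFun_stdGaussian]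
  simp

variable (E) in
/-- The uniform distribution on the unit sphere, as the law of a normalised Gaussian vector. -/
noncomputable def sphereLaw : Measure E := (stdGaussian E).map fun g => ‖g‖⁻¹ • g

instance : IsProbabilityMeasure (sphereLaw E) :=
  Measure.isProbabilityMeasure_map (by fun_prop)

lemma map_sphereLaw (T : E ≃ₗᵢ[ℝ] E) : (sphereLaw E).map T = sphereLaw E := by
  conv_rhs => rw [sphereLaw, ← stdGaussian_map T]
  rw [sphereLaw, Measure.map_map (by fun_prop) (by fun_prop),
    Measure.map_map (by fun_prop) (by fun_prop)]
  congr 1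
  ext g
  simp

lemma ae_orthogonalProjectionOnto_sphereLaw_ne_zero {U : Submodule ℝ E}
    (hU : 0 < Module.finrank ℝ U) : ∀ᵐ u ∂sphereLaw E, U.orthogonalProjectionOnto u ≠ 0 := by
  have hm : Measurable fun g : E => ‖g‖⁻¹ • g := by fun_prop
  have h0 : ∀ᵐ g ∂stdGaussian E, U.orthogonalProjectionOnto g ≠ 0 := by
    have := stdGaussian_singleton_zero (E := U) hU
    rw [← map_orthogonalProjectionOnto_stdGaussian, Measure.map_apply (by fun_prop)
      (measurableSet_singleton _)] at this
    exact measure_eq_zero_iff_ae_notMem.1 this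
  refine (ae_map_iff hm.aemeasurable ?_).2 ?_
  · exact (U.orthogonalProjectionOnto.continuous.measurable (measurableSet_singleton 0)).compl
  · filter_upwards [h0] with g hg
    have : g ≠ 0 := by rintro rfl; simp at hg
    rw [map_smul]
    exact smul_ne_zero (inv_ne_zero (norm_ne_zero_iff.2 this)) hg

lemma ae_sphereLaw_norm_eq_one (hE : 0 < Module.finrank ℝ E) : ∀ᵐ u ∂sphereLaw E, ‖u‖ = 1 := by
  have hm : Measurable fun g : E => ‖g‖⁻¹ • g := by fun_prop
  refine (ae_map_iff hm.aemeasurable (measurableSet_eq_fun (by fun_prop) (by fun_prop))).2 ?_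
  filter_upwards [measure_eq_zero_iff_ae_notMem.1 (stdGaussian_singleton_zero hE)] with g hg
  rw [norm_smul, norm_inv, norm_norm, inv_mul_cancel₀ (norm_ne_zero_iff.2 hg)]

lemma ae_orthogonalProjectionOnto_ne_zero {ν : Measure E} [IsFiniteMeasure ν]
    (hν : ∀ T : E ≃ₗᵢ[ℝ] E, ν.map T = ν) {U : Submodule ℝ E} (hU : 0 < Module.finrank ℝ U) :
    ∀ᵐ y ∂ν.restrict {0}ᶜ, U.orthogonalProjectionOnto y ≠ 0 := by
  have hE : 0 < Module.finrank ℝ E := hU.trans_le U.finrank_le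
  have hm : Measurable fun p : E × E => ‖p.1‖ • p.2 := by fun_prop
  have hc : MeasurableSet {y : E | y ≠ 0 → U.orthogonalProjectionOnto y ≠ 0} := by
    have h1 : MeasurableSet {y : E | U.orthogonalProjectionOnto y = 0} :=
      U.orthogonalProjectionOnto.continuous.measurable (measurableSet_singleton 0)
    have : {y : E | y ≠ 0 → U.orthogonalProjectionOnto y ≠ 0}
        = {0} ∪ {y : E | U.orthogonalProjectionOnto y = 0}ᶜ := by
      ext y
      simp only [Set.mem_ofPred_eq, Set.mem_union, Set.mem_singleton_iff, Set.mem_compl_iff]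
      tauto
    rw [this]
    exact (measurableSet_singleton 0).union h1.compl
  rw [ae_restrict_iff' (measurableSet_singleton 0).compl]
  rw [eq_map_norm_smul hν map_sphereLaw (ae_sphereLaw_norm_eq_one hE)]
  refine (ae_map_iff hm.aemeasurable hc).2 ?_
  have := (Measure.quasiMeasurePreserving_snd (μ := ν) (ν := sphereLaw E)).ae
    (ae_orthogonalProjectionOnto_sphereLaw_ne_zero hU)
  filter_upwards [this] with p hp hp0
  rw [map_smul]
  exact smul_ne_zero (fun h => hp0 (by simp [h])) hp

/-- With `y = ‖y‖ • u`, the logarithm splits as `log ‖y‖²` plus a term in the independent direction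
`u`. -/
lemma integral_cexp_log_orthogonalProjectionOnto {ν : Measure E} [IsFiniteMeasure ν]
    (hν : ∀ T : E ≃ₗᵢ[ℝ] E, ν.map T = ν) {U : Submodule ℝ E} (hU : 0 < Module.finrank ℝ U)
    (t : ℝ) :
    ∫ y in {0}ᶜ, Complex.exp ((t * Real.log (‖U.orthogonalProjectionOnto y‖ ^ 2) : ℝ) * Complex.I) ∂ν
      = (∫ y in {0}ᶜ, Complex.exp ((t * Real.log (‖y‖ ^ 2) : ℝ) * Complex.I) ∂ν)
        * (gaussLogChar (Module.finrank ℝ U) t / gaussLogChar (Module.finrank ℝ E) t) := by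
  have hE : 0 < Module.finrank ℝ E := hU.trans_le U.finrank_le
  -- The constant is chosen before the measure, so the Gaussian case determines it.
  obtain ⟨C, hC⟩ : ∃ C : ℂ, ∀ (ν : Measure E) [IsFiniteMeasure ν]
      (_ : ∀ T : E ≃ₗᵢ[ℝ] E, ν.map T = ν),
      ∫ y in {0}ᶜ, Complex.exp ((t * Real.log (‖U.orthogonalProjectionOnto y‖ ^ 2) : ℝ) * Complex.I) ∂ν
      = (∫ y in {0}ᶜ, Complex.exp ((t * Real.log (‖y‖ ^ 2) : ℝ) * Complex.I) ∂ν) * C := by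
    refine ⟨∫ u, Complex.exp ((t * Real.log (‖U.orthogonalProjectionOnto u‖ ^ 2) : ℝ) * Complex.I)
      ∂sphereLaw E, fun ν _ hν => ?_⟩
    have hm : Measurable fun p : E × E => ‖p.1‖ • p.2 := by fun_prop
    have hmeas : Measurable (Set.indicator {0}ᶜ fun y : E =>
        Complex.exp ((t * Real.log (‖U.orthogonalProjectionOnto y‖ ^ 2) : ℝ) * Complex.I)) :=
      Measurable.indicator (by fun_prop) (measurableSet_singleton 0).compl
    rw [← integral_indicator (measurableSet_singleton 0).compl,
      ← integral_indicator (measurableSet_singleton 0).compl, ← integral_prod_mul]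
    conv_lhs => rw [eq_map_norm_smul hν map_sphereLaw (ae_sphereLaw_norm_eq_one hE)]
    rw [integral_map hm.aemeasurable hmeas.aestronglyMeasurable]
    refine integral_congr_ae ?_
    filter_upwards [(Measure.quasiMeasurePreserving_snd (μ := ν) (ν := sphereLaw E)).ae
      (ae_orthogonalProjectionOnto_sphereLaw_ne_zero hU)] with p hp
    by_cases h : p.1 = 0
    · simp [h]
    · have hp2 : p.2 ≠ 0 := by intro h2; simp [h2] at hp
      have hn : ‖p.1‖ ≠ 0 := norm_ne_zero_iff.2 h
      rw [Set.indicator_of_mem (by simpa using ⟨h, hp2⟩), Set.indicator_of_mem (by simpa using h),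
        ← Complex.exp_add, map_smul, norm_smul, norm_norm, mul_pow,
        Real.log_mul (by positivity) (pow_ne_zero 2 (norm_ne_zero_iff.2 hp))]
      congr 1
      push_cast
      ring
  have hγ : (stdGaussian E).restrict {0}ᶜ = stdGaussian E :=
    Measure.restrict_eq_self_of_ae_mem
      (measure_eq_zero_iff_ae_notMem.1 (stdGaussian_singleton_zero hE))
  have h := hC (stdGaussian E) fun T => stdGaussian_map T
  rw [hγ, integral_cexp_log_norm_sq_stdGaussian hE, ← integral_map (μ := stdGaussian E)
    (f := fun x => Complex.exp ((t * Real.log (‖x‖ ^ 2) : ℝ) * Complex.I)) (by fun_prop)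
    (Measurable.aestronglyMeasurable (by fun_prop)), map_orthogonalProjectionOnto_stdGaussian,
    integral_cexp_log_norm_sq_stdGaussian hU] at h
  rw [hC ν hν, h, mul_div_cancel_left₀ _ (gaussLogChar_ne_zero hE t)]

end Rotation

/-! ### The characteristic function of the log Gram determinant -/

lemma measurePreserving_cons {E : Type*} [MeasurableSpace E] (ν : Measure E) [IsFiniteMeasure ν] (k : ℕ) :
    MeasurePreserving (fun q : (Fin k → E) × E => (Fin.cons q.2 q.1 : Fin (k + 1) → E))
      ((Measure.pi fun _ : Fin k => ν).prod ν) (Measure.pi fun _ : Fin (k + 1) => ν) := by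
  have h := (measurePreserving_piFinSuccAbove (fun _ : Fin (k + 1) => ν) 0).symm.comp
    (Measure.measurePreserving_swap (μ := Measure.pi fun _ : Fin k => ν) (ν := ν))
  convert h using 1
  ext q
  simp [MeasurableEquiv.piFinSuccAbove_symm_apply, Fin.insertNthEquiv]

section Gram

variable {E : Type*} [NormedAddCommGroup E] [InnerProductSpace ℝ E]

lemma continuous_det_gram (k : ℕ) : Continuous fun y : Fin k → E => (Matrix.gram ℝ y).det := by
  refine Continuous.matrix_det (continuous_matrix fun i j => ?_)
  simp only [Matrix.gram_apply]
  fun_prop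

variable [FiniteDimensional ℝ E]

lemma finrank_orthogonal_span {k : ℕ} {y : Fin k → E} (hy : (Matrix.gram ℝ y).det ≠ 0) :
    Module.finrank ℝ (Submodule.span ℝ (Set.range y))ᗮ = Module.finrank ℝ E - k := by
  have h1 := finrank_span_eq_card (Matrix.linearIndependent_of_det_gram_ne_zero hy)
  have h2 := (Submodule.span ℝ (Set.range y)).finrank_add_finrank_orthogonal
  rw [h1, Fintype.card_fin] at h2
  omega

variable [MeasurableSpace E] [BorelSpace E]

/-- Induction on the number of vectors: given the earlier ones, the factor of the new one depends
only on the dimension of their span. That dimension is `k` because the determinant is nonzero, hence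
the joint induction. The restricted measure is not normalised, which keeps the product formula exact
when `ν` has an atom at `0`. -/
lemma det_gram_pi {ν : Measure E} [IsFiniteMeasure ν] (hν : ∀ T : E ≃ₗᵢ[ℝ] E, ν.map T = ν)
    (t : ℝ) {k : ℕ} (hk : k ≤ Module.finrank ℝ E) :
    (∀ᵐ y ∂Measure.pi fun _ : Fin k => ν.restrict {0}ᶜ, (Matrix.gram ℝ y).det ≠ 0) ∧
    ∫ y, Complex.exp ((t * Real.log (Matrix.gram ℝ y).det : ℝ) * Complex.I)
        ∂(Measure.pi fun _ : Fin k => ν.restrict {0}ᶜ)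
      = (∫ y in {0}ᶜ, Complex.exp ((t * Real.log (‖y‖ ^ 2) : ℝ) * Complex.I) ∂ν) ^ k
        * ∏ j ∈ Finset.range k,
          (gaussLogChar (Module.finrank ℝ E - j) t / gaussLogChar (Module.finrank ℝ E) t) := by
  induction k with
  | zero => simp [measureReal_def]
  | succ k ih =>
    obtain ⟨ih1, ih2⟩ := ih (by omega)
    have hmp := measurePreserving_cons (ν.restrict {0}ᶜ) k
    have hdet : Measurable fun y : Fin (k + 1) → E => (Matrix.gram ℝ y).det :=
      (continuous_det_gram (k + 1)).measurable
    have hU : ∀ {y : Fin k → E}, (Matrix.gram ℝ y).det ≠ 0 →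
        0 < Module.finrank ℝ (Submodule.span ℝ (Set.range y))ᗮ := fun hy => by
      rw [finrank_orthogonal_span hy]; omega
    rw [← hmp.map_eq]
    constructor
    · have hs : MeasurableSet {y : Fin (k + 1) → E | (Matrix.gram ℝ y).det ≠ 0} :=
        (hdet (measurableSet_singleton 0)).compl
      rw [ae_map_iff hmp.measurable.aemeasurable hs, Measure.ae_prod_iff_ae_ae
        (p := fun q : (Fin k → E) × E => (Matrix.gram ℝ (Fin.cons q.2 q.1 : Fin (k + 1) → E)).det ≠ 0)
        (hmp.measurable hs)]
      filter_upwards [ih1] with y hy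
      filter_upwards [ae_orthogonalProjectionOnto_ne_zero hν (hU hy)] with x hx
      rw [det_gram_cons]
      exact mul_ne_zero (pow_ne_zero 2 (norm_ne_zero_iff.2 hx)) hy
    · have hF : Measurable fun y : Fin (k + 1) → E =>
          Complex.exp ((t * Real.log (Matrix.gram ℝ y).det : ℝ) * Complex.I) := by fun_prop
      rw [integral_map hmp.measurable.aemeasurable hF.aestronglyMeasurable, integral_prod]
      · have h : ∀ᵐ y ∂Measure.pi fun _ : Fin k => ν.restrict {0}ᶜ,
            ∫ x in {0}ᶜ, Complex.exp ((t * Real.log (Matrix.gram ℝ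
              (Fin.cons x y : Fin (k + 1) → E)).det : ℝ) * Complex.I) ∂ν
            = Complex.exp ((t * Real.log (Matrix.gram ℝ y).det : ℝ) * Complex.I)
              * ((∫ y in {0}ᶜ, Complex.exp ((t * Real.log (‖y‖ ^ 2) : ℝ) * Complex.I) ∂ν)
              * (gaussLogChar (Module.finrank ℝ E - k) t / gaussLogChar (Module.finrank ℝ E) t)) := by
          filter_upwards [ih1] with y hy
          rw [← finrank_orthogonal_span hy,
            ← integral_cexp_log_orthogonalProjectionOnto hν (hU hy), ← integral_const_mul]
          refine integral_congr_ae ?_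
          filter_upwards [ae_orthogonalProjectionOnto_ne_zero hν (hU hy)] with x hx
          rw [det_gram_cons, Real.log_mul (pow_ne_zero 2 (norm_ne_zero_iff.2 hx)) hy,
            ← Complex.exp_add]
          congr 1
          push_cast
          ring
        rw [integral_congr_ae h, integral_mul_const, ih2, Finset.prod_range_succ, pow_succ]
        ring
      · exact Integrable.of_bound (hF.comp hmp.measurable).aestronglyMeasurable 1
          (ae_of_all _ fun _ => (Complex.norm_exp_ofReal_mul_I _).le)

end Gram

/-! ### Passage to the radial and beta laws; the atom at the origin -/

section EuclideanSpace

variable {n p : ℕ} {ν : Measure (EuclideanSpace ℝ (Fin n))}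

lemma logChar_radialLaw (t : ℝ) : logChar (radialLaw ν) (2 * t)
    = ∫ y in {0}ᶜ, Complex.exp ((t * Real.log (‖y‖ ^ 2) : ℝ) * Complex.I) ∂ν := by
  rw [logChar, radialLaw, setIntegral_map measurableSet_Ioi
    (Measurable.aestronglyMeasurable (by fun_prop)) (by fun_prop)]
  have : (fun y : EuclideanSpace ℝ (Fin n) => ‖y‖) ⁻¹' Set.Ioi 0 = {0}ᶜ := by
    ext y; simp
  rw [this]
  congr 1
  ext y
  rw [Real.log_pow]
  congr 3
  push_cast
  ring

lemma ae_radialLaw_nonneg : ∀ᵐ r ∂radialLaw ν, 0 ≤ r :=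
  (ae_map_iff (by fun_prop) measurableSet_Ici).2 (ae_of_all _ fun _ => norm_nonneg _)

variable [IsProbabilityMeasure ν]

instance : IsProbabilityMeasure (radialLaw ν) := Measure.isProbabilityMeasure_map (by fun_prop)

lemma measureReal_zero_le_logTail (s : ℝ) : ν.real {0} ≤ logTail (radialLaw ν) s := by
  have hA : MeasurableSet {r : ℝ | r = 0 ∨ s ≤ |Real.log r|} := (measurableSet_singleton 0).union
    (measurableSet_le measurable_const Real.measurable_log.abs)
  rw [logTail, radialLaw, map_measureReal_apply (by fun_prop) hA]
  refine measureReal_mono ?_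
  rintro y rfl
  simp

lemma integral_cexp_log_det_gram_pi (hν : IsRotationInvariant ν) (hp : p ≤ n) (t : ℝ) :
    ∫ y, Complex.exp ((t * Real.log (Matrix.gram ℝ y).det : ℝ) * Complex.I)
        ∂(Measure.pi fun _ : Fin p => ν.restrict {0}ᶜ)
      = logChar (radialLaw ν) (2 * t) ^ p * ∏ j ∈ Finset.Ico 1 p, logChar (betaLaw n j) t := by
  rw [(det_gram_pi hν t (by simpa using hp)).2, logChar_radialLaw, finrank_euclideanSpace_fin]
  congr 1
  rcases Nat.eq_zero_or_pos p with rfl | h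
  · simp
  -- The factor `j = 0` is `1`: the first vector is not projected.
  · rw [Finset.range_eq_Ico, Finset.prod_eq_prod_Ico_succ_bot h, Nat.sub_zero,
      div_self (gaussLogChar_ne_zero (by omega) t), one_mul]
    refine Finset.prod_congr rfl fun j hj => ?_
    rw [Finset.mem_Ico] at hj
    rw [logChar_betaLaw (by omega) (by omega)]

lemma measureReal_pi_exists_zero_le :
    (Measure.pi fun _ : Fin p => ν).real (Set.univ.pi fun _ => {0}ᶜ)ᶜ ≤ p * ν.real {0} := by
  have : (Set.univ.pi fun _ : Fin p => ({0}ᶜ : Set (EuclideanSpace ℝ (Fin n))))ᶜ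
      = ⋃ i : Fin p, (fun y => y i) ⁻¹' {0} := by
    ext y; simp
  rw [this]
  refine (measureReal_iUnion_fintype_le _).trans ?_
  have h : ∀ i : Fin p, (Measure.pi fun _ : Fin p => ν).real ((fun y => y i) ⁻¹' {0}) = ν.real {0} :=
    fun i => (measurePreserving_eval (fun _ : Fin p => ν) i).measureReal_preimage
      (measurableSet_singleton 0).nullMeasurableSet
  simp [h]

lemma measureReal_pi_det_gram_eq_zero_le (hν : IsRotationInvariant ν) (hp : p ≤ n) :
    (Measure.pi fun _ : Fin p => ν).real {y | (Matrix.gram ℝ y).det = 0} ≤ p * ν.real {0} := by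
  refine le_trans ?_ measureReal_pi_exists_zero_le
  have h := (det_gram_pi (k := p) hν 0 (by simpa using hp)).1
  rw [← Measure.restrict_pi_pi, ae_restrict_iff' (MeasurableSet.univ_pi fun _ =>
    (measurableSet_singleton 0).compl)] at h
  refine ENNReal.toReal_mono (measure_ne_top _ _) (measure_mono_ae ?_)
  filter_upwards [h] with y hy hy0 hys
  exact hy hys hy0

/-- The integrals differ only over the event that some vector is zero, where the integrand has
modulus `1` whatever value the logarithm of `0` is given. -/
lemma norm_integral_pi_sub_le (F : (Fin p → EuclideanSpace ℝ (Fin n)) → ℝ) (hF : Measurable F) :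
    ‖∫ y, Complex.exp (F y * Complex.I) ∂(Measure.pi fun _ : Fin p => ν)
      - ∫ y, Complex.exp (F y * Complex.I) ∂(Measure.pi fun _ : Fin p => ν.restrict {0}ᶜ)‖
      ≤ p * ν.real {0} := by
  have hS : MeasurableSet (Set.univ.pi fun _ : Fin p => ({0}ᶜ : Set (EuclideanSpace ℝ (Fin n)))) :=
    MeasurableSet.univ_pi fun _ => (measurableSet_singleton 0).compl
  have hi : Integrable (fun y => Complex.exp (F y * Complex.I)) (Measure.pi fun _ : Fin p => ν) :=
    Integrable.of_bound (Measurable.aestronglyMeasurable (by fun_prop)) 1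
      (ae_of_all _ fun _ => (Complex.norm_exp_ofReal_mul_I _).le)
  rw [← Measure.restrict_pi_pi, ← integral_add_compl hS hi, add_sub_cancel_left]
  refine (norm_integral_le_of_norm_le_const
    (ae_of_all _ fun y => (Complex.norm_exp_ofReal_mul_I (F y)).le)).trans ?_
  simpa using measureReal_pi_exists_zero_le (ν := ν) (p := p)

end EuclideanSpace

/-! ### Gaussian approximation of the log-volume -/

lemma isProbabilityMeasure_betaLaw {n j : ℕ} (hj : 0 < j) (hjn : j < n) :
    IsProbabilityMeasure (betaLaw n j) := by
  have hj' : (0 : ℝ) < j := by exact_mod_cast hj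
  have hjn' : (j : ℝ) < n := by exact_mod_cast hjn
  exact isProbabilityMeasureBeta (by linarith) (by linarith)

lemma ae_betaLaw_nonneg (n j : ℕ) : ∀ᵐ r ∂betaLaw n j, 0 ≤ r := by
  have hm : Measurable (betaPDF (((n : ℝ) - j) / 2) ((j : ℝ) / 2)) :=
    (measurable_betaPDFReal _ _).ennreal_ofReal
  rw [betaLaw, betaMeasure, ae_withDensity_iff hm]
  refine ae_of_all _ fun r hr => ?_
  by_contra h
  exact hr (betaPDF_eq_zero_of_nonpos (not_le.1 h).le)

lemma logTail_nonneg (ρ : Measure ℝ) (s : ℝ) : 0 ≤ logTail ρ s := measureReal_nonneg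

/-- All factors have modulus at most `1`, so the error of the product is at most the sum of the
errors, which is a multiple of `ε V + T`. The beta logarithms enter the log-volume with weight `1 /
2`, which explains the scale `2 σ`. -/
lemma norm_logChar_pow_mul_prod_sub_exp_le {n p : ℕ} (hp : p ≤ n) {ρ : Measure ℝ}
    [IsProbabilityMeasure ρ] (hρ : ∀ᵐ r ∂ρ, 0 ≤ r) {σ ε V T : ℝ} (hσ : 0 < σ) (hε : 0 < ε)
    (hε1 : ε ≤ 1)
    (hV : V = p * truncLogVar ρ σ / σ ^ 2
      + 1 / (4 * σ ^ 2) * ∑ j ∈ Finset.Ico 1 p, truncLogVar (betaLaw n j) (2 * σ))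
    (hT : T = p * logTail ρ (ε * σ) + ∑ j ∈ Finset.Ico 1 p, logTail (betaLaw n j) (2 * ε * σ))
    (hTε : T ≤ ε) (t : ℝ) :
    ‖logChar ρ (2 * (t / (2 * σ))) ^ p
          * (∏ j ∈ Finset.Ico 1 p, logChar (betaLaw n j) (t / (2 * σ)))
          * Complex.exp ((-(t * ((p * truncLogMean ρ σ
            + 1 / 2 * ∑ j ∈ Finset.Ico 1 p, truncLogMean (betaLaw n j) (2 * σ)) / σ)) : ℝ)
            * Complex.I)
        - Complex.exp ((-(t ^ 2 * V / 2) : ℝ))‖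
      ≤ (32 * |t| ^ 3 + t ^ 4 + 2) * (ε * V + T) := by
  set K := 32 * |t| ^ 3 + t ^ 4 + 2
  have hsum0 : 0 ≤ ∑ j ∈ Finset.Ico 1 p, logTail (betaLaw n j) (2 * ε * σ) :=
    Finset.sum_nonneg fun _ _ => logTail_nonneg _ _
  have hp0 : (0 : ℝ) ≤ p := Nat.cast_nonneg p
  set a : ℂ := logChar ρ (t / σ) * Complex.exp ((-(t * (truncLogMean ρ σ / σ)) : ℝ) * Complex.I)
  set a' : ℂ := Complex.exp ((-(t ^ 2 * (truncLogVar ρ σ / σ ^ 2) / 2) : ℝ))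
  let c : ℕ → ℂ := fun j => logChar (betaLaw n j) (t / (2 * σ))
    * Complex.exp ((-(t * (truncLogMean (betaLaw n j) (2 * σ) / (2 * σ))) : ℝ) * Complex.I)
  let c' : ℕ → ℂ := fun j =>
    Complex.exp ((-(t ^ 2 * (truncLogVar (betaLaw n j) (2 * σ) / (2 * σ) ^ 2) / 2) : ℝ))
  have hexp : ∀ v : ℝ, 0 ≤ v → ‖Complex.exp ((-(t ^ 2 * v / 2) : ℝ))‖ ≤ 1 := fun v hv => by
    rw [Complex.norm_exp, Complex.ofReal_re, Real.exp_le_one_iff, neg_nonpos]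
    positivity
  -- Membership in the range gives `p ≥ 1`, needed to bound a single tail by `T`.
  have ha : ∀ i ∈ Finset.range p, ‖a‖ ≤ 1 ∧ ‖a'‖ ≤ 1
      ∧ ‖a - a'‖ ≤ K * (ε * (truncLogVar ρ σ / σ ^ 2) + logTail ρ (ε * σ)) := fun i hi => by
    have hp1 : (1 : ℝ) ≤ p := by
      have := Finset.mem_range.1 hi
      exact_mod_cast (by omega : 1 ≤ p)
    have hq : logTail ρ (ε * σ) ≤ ε := by
      have := le_mul_of_one_le_left (logTail_nonneg ρ (ε * σ)) hp1
      linarith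
    obtain ⟨h1, h2⟩ := norm_logChar_mul_sub_exp_le ρ hρ hσ hε hε1 hq t
    refine ⟨?_, hexp _ h1, h2⟩
    rw [norm_mul, Complex.norm_exp_ofReal_mul_I, mul_one]
    exact norm_logChar_le _ _
  have hc : ∀ j ∈ Finset.Ico 1 p, ‖c j‖ ≤ 1 ∧ ‖c' j‖ ≤ 1
      ∧ ‖c j - c' j‖ ≤ K * (ε * (truncLogVar (betaLaw n j) (2 * σ) / (2 * σ) ^ 2)
        + logTail (betaLaw n j) (2 * ε * σ)) := fun j hj => by
    have hjp := Finset.mem_Ico.1 hj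
    have := isProbabilityMeasure_betaLaw (n := n) (j := j) (by omega) (by omega)
    have hεσ : ε * (2 * σ) = 2 * ε * σ := by ring
    have hq : logTail (betaLaw n j) (ε * (2 * σ)) ≤ ε := by
      have := Finset.single_le_sum (f := fun j => logTail (betaLaw n j) (2 * ε * σ))
        (fun _ _ => logTail_nonneg _ _) hj
      have := mul_nonneg hp0 (logTail_nonneg ρ (ε * σ))
      rw [hεσ]
      linarith
    obtain ⟨h1, h2⟩ := norm_logChar_mul_sub_exp_le (betaLaw n j) (ae_betaLaw_nonneg n j)
      (by positivity : 0 < 2 * σ) hε hε1 hq t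
    rw [hεσ] at h2
    refine ⟨?_, hexp _ h1, h2⟩
    rw [norm_mul, Complex.norm_exp_ofReal_mul_I, mul_one]
    exact norm_logChar_le _ _
  have e1 : logChar ρ (2 * (t / (2 * σ))) ^ p
          * (∏ j ∈ Finset.Ico 1 p, logChar (betaLaw n j) (t / (2 * σ)))
          * Complex.exp ((-(t * ((p * truncLogMean ρ σ
            + 1 / 2 * ∑ j ∈ Finset.Ico 1 p, truncLogMean (betaLaw n j) (2 * σ)) / σ)) : ℝ)
            * Complex.I)
      = (∏ _i ∈ Finset.range p, a) * ∏ j ∈ Finset.Ico 1 p, c j := by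
    have : Complex.exp ((-(t * ((p * truncLogMean ρ σ
            + 1 / 2 * ∑ j ∈ Finset.Ico 1 p, truncLogMean (betaLaw n j) (2 * σ)) / σ)) : ℝ)
            * Complex.I)
        = Complex.exp ((-(t * (truncLogMean ρ σ / σ)) : ℝ) * Complex.I) ^ p
          * ∏ j ∈ Finset.Ico 1 p, Complex.exp
            ((-(t * (truncLogMean (betaLaw n j) (2 * σ) / (2 * σ))) : ℝ) * Complex.I) := by
      rw [← Complex.exp_nat_mul, ← Complex.exp_sum, ← Complex.exp_add, ← Finset.sum_mul,
        ← Complex.ofReal_sum, Finset.sum_neg_distrib, ← Finset.mul_sum, ← Finset.sum_div]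
      congr 1
      push_cast
      have : (σ : ℂ) ≠ 0 := by exact_mod_cast hσ.ne'
      field_simp
      ring
    simp only [a, c]
    rw [this, Finset.prod_const, Finset.card_range, Finset.prod_mul_distrib, mul_pow,
      show 2 * (t / (2 * σ)) = t / σ by field_simp]
    ring
  have e2 : Complex.exp ((-(t ^ 2 * V / 2) : ℝ))
      = (∏ _i ∈ Finset.range p, a') * ∏ j ∈ Finset.Ico 1 p, c' j := by
    rw [Finset.prod_const, Finset.card_range, ← Complex.exp_nat_mul, ← Complex.exp_sum,
      ← Complex.exp_add, ← Complex.ofReal_sum, Finset.sum_neg_distrib, ← Finset.sum_div,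
      ← Finset.mul_sum, ← Finset.sum_div, hV]
    congr 1
    push_cast
    have : (σ : ℂ) ≠ 0 := by exact_mod_cast hσ.ne'
    field_simp
    ring
  have n1 : ‖∏ j ∈ Finset.Ico 1 p, c j‖ ≤ 1 := by
    rw [norm_prod]
    exact Finset.prod_le_one (fun _ _ => norm_nonneg _) fun j hj => (hc j hj).1
  have n2 : ‖∏ _i ∈ Finset.range p, a'‖ ≤ 1 := by
    rw [norm_prod]
    exact Finset.prod_le_one (fun _ _ => norm_nonneg _) fun i hi => (ha i hi).2.1
  have d1 := (norm_prod_sub_prod_le (Finset.range p) (fun _ => a) (fun _ => a')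
    (fun i hi => (ha i hi).1) fun i hi => (ha i hi).2.1).trans
      (Finset.sum_le_sum fun i hi => (ha i hi).2.2)
  have d2 := (norm_prod_sub_prod_le (Finset.Ico 1 p) c c'
    (fun i hi => (hc i hi).1) fun i hi => (hc i hi).2.1).trans
      (Finset.sum_le_sum fun i hi => (hc i hi).2.2)
  rw [e1, e2, show (∏ _i ∈ Finset.range p, a) * ∏ j ∈ Finset.Ico 1 p, c j
        - (∏ _i ∈ Finset.range p, a') * ∏ j ∈ Finset.Ico 1 p, c' j
      = (∏ _i ∈ Finset.range p, a - ∏ _i ∈ Finset.range p, a') * ∏ j ∈ Finset.Ico 1 p, c j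
        + (∏ _i ∈ Finset.range p, a') * (∏ j ∈ Finset.Ico 1 p, c j - ∏ j ∈ Finset.Ico 1 p, c' j)
      by ring]
  refine (norm_add_le _ _).trans ?_
  rw [norm_mul, norm_mul]
  refine (add_le_add ((mul_le_of_le_one_right (norm_nonneg _) n1).trans d1)
    ((mul_le_of_le_one_left (norm_nonneg _) n2).trans d2)).trans (le_of_eq ?_)
  rw [Finset.sum_const, Finset.card_range, ← Finset.mul_sum, Finset.sum_add_distrib,
    ← Finset.mul_sum, ← Finset.sum_div, hV, hT, nsmul_eq_mul]
  field_simp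
  ring

lemma log_simplexVolume {n p : ℕ} {y : Fin p → EuclideanSpace ℝ (Fin n)}
    (hy : (Matrix.gram ℝ y).det ≠ 0) :
    Real.log (simplexVolume y) = 1 / 2 * Real.log (Matrix.gram ℝ y).det - Real.log (p ! : ℝ) := by
  have h : 0 < (Matrix.gram ℝ y).det :=
    lt_of_le_of_ne (Matrix.posSemidef_gram ℝ y).det_nonneg (Ne.symm hy)
  rw [simplexVolume_eq, Real.log_div (Real.sqrt_ne_zero'.2 h) (by positivity),
    Real.log_sqrt h.le]
  ring

lemma simplexVolume_eq_zero_iff {n p : ℕ} {y : Fin p → EuclideanSpace ℝ (Fin n)} :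
    simplexVolume y = 0 ↔ (Matrix.gram ℝ y).det = 0 := by
  have h : (p ! : ℝ) ≠ 0 := by positivity
  rw [simplexVolume_eq, div_eq_zero_iff, or_iff_left h,
    Real.sqrt_eq_zero (Matrix.posSemidef_gram ℝ y).det_nonneg]

lemma measurable_simplexVolume {n p : ℕ} :
    Measurable fun y : Fin p → EuclideanSpace ℝ (Fin n) => simplexVolume y := by
  simp_rw [simplexVolume_eq]
  exact ((continuous_det_gram p).sqrt.div_const _).measurable

/-- The centring error `d` only contributes a phase; the extra `T` pays for the atom at the origin.
-/
lemma norm_integral_cexp_log_simplexVolume_sub_exp_le {n p : ℕ} (hp : p ≤ n)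
    {ν : Measure (EuclideanSpace ℝ (Fin n))} [IsProbabilityMeasure ν] (hν : IsRotationInvariant ν)
    {σ ε V T b d : ℝ} (hσ : 0 < σ) (hε : 0 < ε) (hε1 : ε ≤ 1)
    (hV : V = p * truncLogVar (radialLaw ν) σ / σ ^ 2
      + 1 / (4 * σ ^ 2) * ∑ j ∈ Finset.Ico 1 p, truncLogVar (betaLaw n j) (2 * σ))
    (hT : T = p * logTail (radialLaw ν) (ε * σ)
      + ∑ j ∈ Finset.Ico 1 p, logTail (betaLaw n j) (2 * ε * σ))
    (hd : d = b - (p * truncLogMean (radialLaw ν) σ - Real.log (p ! : ℝ)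
      + 1 / 2 * ∑ j ∈ Finset.Ico 1 p, truncLogMean (betaLaw n j) (2 * σ)))
    (hTε : T ≤ ε) (t : ℝ) :
    ‖∫ y, Complex.exp ((t * ((Real.log (simplexVolume y) - b) / σ) : ℝ) * Complex.I)
          ∂(Measure.pi fun _ : Fin p => ν)
        - Complex.exp ((-(t ^ 2 * V / 2) : ℝ)) * Complex.exp ((-(t * (d / σ)) : ℝ) * Complex.I)‖
      ≤ (32 * |t| ^ 3 + t ^ 4 + 2) * (ε * V + T) + T := by
  have hmeas : Measurable fun y : Fin p → EuclideanSpace ℝ (Fin n) =>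
      t * ((Real.log (simplexVolume y) - b) / σ) := by
    have := measurable_simplexVolume (n := n) (p := p)
    fun_prop
  have h1 := norm_integral_pi_sub_le (ν := ν) _ hmeas
  have hT1 : p * ν.real {0} ≤ T := by
    have h2 := measureReal_zero_le_logTail (ν := ν) (ε * σ)
    have h3 : 0 ≤ ∑ j ∈ Finset.Ico 1 p, logTail (betaLaw n j) (2 * ε * σ) :=
      Finset.sum_nonneg fun _ _ => logTail_nonneg _ _
    have h4 := mul_le_mul_of_nonneg_left h2 (Nat.cast_nonneg (α := ℝ) p)
    linarith
  have h2 : ∫ y, Complex.exp ((t * ((Real.log (simplexVolume y) - b) / σ) : ℝ) * Complex.I)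
        ∂(Measure.pi fun _ : Fin p => ν.restrict {0}ᶜ)
      = logChar (radialLaw ν) (2 * (t / (2 * σ))) ^ p
          * (∏ j ∈ Finset.Ico 1 p, logChar (betaLaw n j) (t / (2 * σ)))
          * Complex.exp ((-(t * ((p * truncLogMean (radialLaw ν) σ
            + 1 / 2 * ∑ j ∈ Finset.Ico 1 p, truncLogMean (betaLaw n j) (2 * σ)) / σ)) : ℝ)
            * Complex.I) * Complex.exp ((-(t * (d / σ)) : ℝ) * Complex.I) := by
    rw [← integral_cexp_log_det_gram_pi hν hp, mul_assoc, ← Complex.exp_add, ← integral_mul_const]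
    refine integral_congr_ae ?_
    filter_upwards [(det_gram_pi (k := p) hν 0 (by simpa using hp)).1] with y hy
    rw [log_simplexVolume hy, ← Complex.exp_add, hd]
    congr 1
    have : (σ : ℂ) ≠ 0 := by exact_mod_cast hσ.ne'
    push_cast
    field_simp
    ring
  have h3 := norm_logChar_pow_mul_prod_sub_exp_le hp (ρ := radialLaw ν) ae_radialLaw_nonneg hσ hε
    hε1 hV hT hTε t
  refine (norm_sub_le_norm_sub_add_norm_sub _ _ _).trans ((add_le_add h1 ?_).trans
    ((add_comm _ _).trans_le (add_le_add_right hT1 _)))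
  rw [h2, ← sub_mul, norm_mul, Complex.norm_exp_ofReal_mul_I, mul_one]
  exact h3

/-! ### The central limit theorem -/

theorem theoremD
    (p : ℕ → ℕ) (hp : Tendsto p atTop atTop) (hpn : ∀ n, p n ≤ n)
    {Ω : ℕ → Type*} [∀ n, MeasurableSpace (Ω n)]
    (P : ∀ n, Measure (Ω n)) [∀ n, IsProbabilityMeasure (P n)]
    (Y : ∀ n, Fin (p n) → Ω n → EuclideanSpace ℝ (Fin n))
    (ν : ∀ n, Measure (EuclideanSpace ℝ (Fin n))) [∀ n, IsProbabilityMeasure (ν n)]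
    (hlaw : ∀ n i, HasLaw (Y n i) (ν n) (P n))
    (hindep : ∀ n, iIndepFun (Y n) (P n))
    (hrot : ∀ n, IsRotationInvariant (ν n))
    (σ : ℕ → ℝ) (hσ : ∀ n, 0 < σ n)
    (hvar : Tendsto (fun n =>
        (p n : ℝ) * truncLogVar (radialLaw (ν n)) (σ n) / (σ n) ^ 2
          + 1 / (4 * (σ n) ^ 2)
            * ∑ j ∈ Finset.Ico 1 (p n), truncLogVar (betaLaw n j) (2 * σ n))
      atTop (𝓝 1))
    (hneg : ∀ ε : ℝ, 0 < ε → Tendsto (fun n =>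
        (p n : ℝ) * logTail (radialLaw (ν n)) (ε * σ n)
          + ∑ j ∈ Finset.Ico 1 (p n), logTail (betaLaw n j) (2 * ε * σ n))
      atTop (𝓝 0))
    (b : ℕ → ℝ)
    (hb : (fun n => b n -
        ((p n : ℝ) * truncLogMean (radialLaw (ν n)) (σ n) - Real.log ((p n)! : ℝ)
          + 1 / 2 * ∑ j ∈ Finset.Ico 1 (p n), truncLogMean (betaLaw n j) (2 * σ n)))
      =o[atTop] σ)
    {Ω' : Type*} [MeasurableSpace Ω'] (P' : Measure Ω') [IsProbabilityMeasure P']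
    (N : Ω' → ℝ) (hN : HasLaw N (gaussianReal 0 1) P') :
    -- the volume is nonzero with probability tending to one, so that the value of `log 0`
    -- plays no role
    Tendsto (fun n => (P n).real {ω | simplexVolume (fun i => Y n i ω) = 0}) atTop (𝓝 0) ∧
    TendstoInDistribution
      (fun n ω => (Real.log (simplexVolume (fun i => Y n i ω)) - b n) / σ n)
      atTop N P P' := by
  have hlawpi : ∀ n, (P n).map (fun ω i => Y n i ω) = Measure.pi fun _ : Fin (p n) => ν n := by
    intro n
    rw [(iIndepFun_iff_map_fun_eq_pi_map fun i => (hlaw n i).aemeasurable).1 (hindep n)]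
    simp_rw [(hlaw n _).map_eq]
  have hY : ∀ n, AEMeasurable (fun ω i => Y n i ω) (P n) := fun n =>
    aemeasurable_pi_lambda _ fun i => (hlaw n i).aemeasurable
  have hZ : ∀ n, Measurable fun y : Fin (p n) → EuclideanSpace ℝ (Fin n) =>
      (Real.log (simplexVolume y) - b n) / σ n := fun n => by
    have := measurable_simplexVolume (n := n) (p := p n)
    fun_prop
  have hZY : ∀ n, AEMeasurable (fun ω =>
      (Real.log (simplexVolume (fun i => Y n i ω)) - b n) / σ n) (P n) := fun n =>
    (hZ n).comp_aemeasurable (hY n)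
  have hZY : ∀ n, AEMeasurable (fun ω =>
      (Real.log (simplexVolume (fun i => Y n i ω)) - b n) / σ n) (P n) := fun n =>
    (hZ n).comp_aemeasurable (hY n)
  set T : ℝ → ℕ → ℝ := fun ε n => (p n : ℝ) * logTail (radialLaw (ν n)) (ε * σ n)
    + ∑ j ∈ Finset.Ico 1 (p n), logTail (betaLaw n j) (2 * ε * σ n)
  set V : ℕ → ℝ := fun n => (p n : ℝ) * truncLogVar (radialLaw (ν n)) (σ n) / (σ n) ^ 2
    + 1 / (4 * (σ n) ^ 2) * ∑ j ∈ Finset.Ico 1 (p n), truncLogVar (betaLaw n j) (2 * σ n)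
  set d : ℕ → ℝ := fun n => b n - ((p n : ℝ) * truncLogMean (radialLaw (ν n)) (σ n)
    - Real.log ((p n)! : ℝ) + 1 / 2 * ∑ j ∈ Finset.Ico 1 (p n), truncLogMean (betaLaw n j) (2 * σ n))
  have hd : Tendsto (fun n => d n / σ n) atTop (𝓝 0) := hb.tendsto_div_nhds_zero
  refine ⟨?_, hZY, hN.aemeasurable, ?_⟩
  -- The volume vanishes with probability at most `p ν{0}`, which the tail condition with `ε = 1`
  -- dominates.
  · refine squeeze_zero (fun n => measureReal_nonneg) (fun n => ?_) (hneg 1 one_pos)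
    have hs : MeasurableSet {y : Fin (p n) → EuclideanSpace ℝ (Fin n) | simplexVolume y = 0} :=
      measurable_simplexVolume (measurableSet_singleton 0)
    have h1 : (P n).real {ω | simplexVolume (fun i => Y n i ω) = 0}
        = (Measure.pi fun _ : Fin (p n) => ν n).real {y | simplexVolume y = 0} := by
      rw [← hlawpi n, map_measureReal_apply_of_aemeasurable (hY n) hs]
      rfl
    rw [h1]
    simp_rw [simplexVolume_eq_zero_iff]
    refine (measureReal_pi_det_gram_eq_zero_le (hrot n) (hpn n)).trans ?_
    refine (mul_le_mul_of_nonneg_left (measureReal_zero_le_logTail (1 * σ n))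
      (Nat.cast_nonneg _)).trans (le_add_of_nonneg_right ?_)
    exact Finset.sum_nonneg fun _ _ => logTail_nonneg _ _
  · refine ProbabilityMeasure.tendsto_iff_tendsto_charFun.2 fun t => ?_
    simp only [ProbabilityMeasure.coe_mk]
    rw [hN.map_eq, charFun_gaussianReal]
    have hchar : ∀ n, charFun ((P n).map fun ω =>
        (Real.log (simplexVolume (fun i => Y n i ω)) - b n) / σ n) t
        = ∫ y, Complex.exp ((t * ((Real.log (simplexVolume y) - b n) / σ n) : ℝ) * Complex.I)
          ∂(Measure.pi fun _ : Fin (p n) => ν n) := by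
      intro n
      rw [charFun_apply_real, integral_map (hZY n) (by fun_prop),
        ← hlawpi n, integral_map (hY n)
          (by have := hZ n; exact Measurable.aestronglyMeasurable (by fun_prop))]
      push_cast
      rfl
    simp_rw [hchar]
    set K : ℝ := 32 * |t| ^ 3 + t ^ 4 + 2
    have hlim : Tendsto (fun n => Complex.exp ((-(t ^ 2 * V n / 2) : ℝ))
        * Complex.exp ((-(t * (d n / σ n)) : ℝ) * Complex.I)) atTop
        (𝓝 (Complex.exp ((-(t ^ 2 * 1 / 2) : ℝ)) * Complex.exp ((-(t * 0) : ℝ) * Complex.I))) := by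
      refine Tendsto.mul ?_ ?_
      · exact (Complex.continuous_exp.comp Complex.continuous_ofReal).continuousAt.tendsto.comp
          (((hvar.const_mul _).div_const 2).neg)
      · exact (Complex.continuous_exp.comp
          (Complex.continuous_ofReal.mul continuous_const)).continuousAt.tendsto.comp
          ((hd.const_mul t).neg)
    have hdiff : Tendsto (fun n =>
        ∫ y, Complex.exp ((t * ((Real.log (simplexVolume y) - b n) / σ n) : ℝ) * Complex.I)
          ∂(Measure.pi fun _ : Fin (p n) => ν n)
        - Complex.exp ((-(t ^ 2 * V n / 2) : ℝ))
          * Complex.exp ((-(t * (d n / σ n)) : ℝ) * Complex.I)) atTop (𝓝 0) := by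
      rw [Metric.tendsto_nhds]
      intro δ hδ
      have hK : 0 < K := by positivity
      -- For fixed `ε` the error bound tends to `K ε`, so it suffices to make this smaller than `δ`.
      obtain ⟨ε, hε, hε1, hεδ⟩ : ∃ ε : ℝ, 0 < ε ∧ ε ≤ 1 ∧ K * (ε * 2) < δ := by
        refine ⟨min 1 (δ / (4 * K)), by positivity, min_le_left _ _, ?_⟩
        have := min_le_right 1 (δ / (4 * K))
        calc K * (min 1 (δ / (4 * K)) * 2) ≤ K * (δ / (4 * K) * 2) := by gcongr
          _ = δ / 2 := by field_simp; ring
          _ < δ := half_lt_self hδ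
      have hb1 : Tendsto (fun n => K * (ε * V n + T ε n) + T ε n) atTop
          (𝓝 (K * (ε * 1 + 0) + 0)) :=
        (((hvar.const_mul ε).add (hneg ε hε)).const_mul K).add (hneg ε hε)
      have hlt : K * (ε * 1 + 0) + 0 < δ := by nlinarith
      filter_upwards [hb1.eventually_lt_const hlt, (hneg ε hε).eventually_le_const hε]
        with n hn hTn
      rw [dist_zero_right]
      exact (norm_integral_cexp_log_simplexVolume_sub_exp_le (hpn n) (hrot n) (hσ n) hε hε1 rfl rfl
        rfl hTn t).trans_lt hn
    have := hdiff.add hlim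
    simp only [sub_add_cancel] at this
    convert this using 2
    rw [zero_add, ← Complex.exp_add]
    congr 1
    push_cast
    simp
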